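/- **Theorem (safety bound).** Let $L\ge 1$ be the number of votes (proofs) that make up a block, $\lambda_B>0$ the block rate, $\lambda_P=L\lambda_B$ the proof rate, $\beta\in[0,1]$ the fraction of honest mining power, $\delta\ge 0$ the maximal delay of a proof and $\Delta\ge 0$ the maximal delay of a ledger. Put $p=\beta e^{-\lambda_P\delta}$ and $q=1-p$, and assume $p>\tfrac12$. *Rigged model.* Proofs are mined at the points of a Poisson process of rate $\lambda_P$ on $(0,\infty)$, and each is found by an honest miner with probability $\beta$, independently of everything else. Every proof refers to one earlier proof, so that the proofs form a tree rooted at a genesis. Some honestly found proofs are converted into adversarial ones, as follows. Let $\tau$ be the time when block $h$ is complete; it is either the time of the $n$-th proof or the time of the $k$-th unconverted honest proof (for example $k=hL$), for an arbitrary fixed $n$ or $k$. * Up to $\tau$ (pre-mining; ledger delays are ignored and all proofs of honest miners count as proofs of block $h$), an honestly found proof is converted if it is mined less than $\delta$ after the preceding proof (after time $0$ for the first proof). * From $\tau$ on, all honestly found proofs are converted during $[\tau,\tau+\Delta]$ (delivery of the ledger of block $h$), then during the $\delta$ time units following each unconverted honest proof, and for a further $\Delta$ time units after the delay of the $L$-th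 unconverted honest proof (delivery of the ledger of block $h+1$). The end of this last period is the confirmation time $\tau_c$. * After $\tau_c$ (ledger delays are again ignored), an honestly found proof is converted if it is mined less than $\delta$ after $\tau_c$ or after the preceding proof. Unconverted honest proofs are honest; all other proofs are adversarial. A view at a given time is a set of proofs mined so far, closed under predecessors, that contains the genesis, all honest proofs mined so far, and any adversarial proofs the adversary has chosen to reveal. Each honest proof extends a heaviest chain (one with the most proofs) in some view held just before it is mined, ties being broken by the adversary. A chain leaves block $h$ when a proof on it votes for a ledger of block $h$; every later proof on that chain inherits this vote. A proof mined by an honest miner on a chain still in block $h$ stays in block $h$ up to $\tau$ and votes for some ledger of block $h$ after $\tau$. The adversary is otherwise arbitrary: it decides where each adversarial proof is attached, what that proof votes for, and when and to whom it is revealed, and its choices may depend on the whole outcome of the mining process. *1-block confirmation rule.* A ledger $\ell$ of block $h$ is confirmed when, at a time not before $\tau_c$, a heaviest chain in some view contains at least $L$ votes for $\ell$ (so block $h+1$ is complete). It is discarded if, at the same or a later time, a heaviest chain in some view does not carry the vote for $\ell$. *Conclusion.* Against every adversary, the probability that a confirmed ledger of block $h$ with $L$ votes is discarded is at most $$P\big(M_{lead}+S_{L}+S_{\delta_L}+S_{\Delta_2}+M_{deficit}\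 \ge\ L\big),$$ where the five summands are independent and * $M_{lead}$ and $M_{deficit}$ have the geometric distribution $\mathrm{Geo}(1-q/p)$ on $\{0,1,2,\dots\}$, i.e. $P(M=k)=(1-\tfrac qp)(\tfrac qp)^k$; * $S_L\sim \mathrm{NegBin}(L,\beta)$ is the sum of $L$ independent variables with $P(G=k)=\beta(1-\beta)^k$, $k\ge 0$; * $S_{\delta_L}$ is the sum of $L$ independent $\mathrm{Poisson}(\lambda_P\delta)$ variables; * $S_{\Delta_2}$ is the sum of two independent $\mathrm{Poisson}(\lambda_P\Delta)$ variables. -/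

import Mathlib

open MeasureTheory ProbabilityTheory

noncomputable section

namespace RiggedPoW

/-! ### Parameters and sample paths of the mining process -/

/-- When the pre-mining phase ends, i.e. which proof completes block `h` (at time `τ`).
`afterProofs n`: after `n` proofs in total (the lead process is inspected at an arbitrary,
exogenous step, as in a steady-state analysis).
`afterHonest k`: after `k` honest proofs (for instance `k = h * L`: honest miners have completed
`h` blocks of `L` sequential proofs). -/
inductive PreMining where
  | afterProofs (n : ℕ)
  | afterHonest (k : ℕ)

/-- Deterministic parameters: number `L` of votes in a block, maximal proof delay `δ`, maximal
ledger delay `Δ`, and the rule that ends the pre-mining phase. -/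
structure Params where
  L : ℕ
  δ : ℝ
  Δ : ℝ
  pre : PreMining

/-- A sample path of the mining process. Proofs are numbered `1, 2, 3, …` in the order in which
they are mined (`0` stands for the genesis). `gap i` is the time between proof `i - 1` and
proof `i`, and `byHonest i` tells whether proof `i` is found by an honest miner.
The values at `0` are not used. -/
structure MiningPath where
  gap : ℕ → ℝ
  byHonest : ℕ → Bool

/-- The time at which proof `n` is mined (the genesis has time `0`). -/
def MiningPath.time (m : MiningPath) (n : ℕ) : ℝ := ∑ i ∈ Finset.Icc 1 n, m.gap i

/-- Pre-mining phase: a proof of an honest miner stays honest iff no proof was mined during the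
preceding `δ` time units; all other proofs count as adversarial. -/
def preHonest (P : Params) (m : MiningPath) (i : ℕ) : Prop :=
  1 ≤ i ∧ m.byHonest i = true ∧ P.δ ≤ m.gap i

open Classical in
/-- The number of proofs mined until time `τ`, the end of the pre-mining phase. -/
def preCount (P : Params) (m : MiningPath) : ℕ :=
  match P.pre with
  | .afterProofs n => n
  | .afterHonest k => sInf {n : ℕ | k ≤ ((Finset.Icc 1 n).filter (preHonest P m)).card}

/-- The time `τ` at which block `h` is complete and its ledger starts to be disseminated. -/
def tau (P : Params) (m : MiningPath) : ℝ := m.time (preCount P m)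

/-- State of the confirmation interval: the number of honest votes mined since `τ`, and the time
until which honest mining power currently works for the adversary. -/
structure ConfState where
  votes : ℕ
  resume : ℝ

open Classical in
/-- State of the confirmation interval after the first `n` proofs. Honest miners are idle during
`[τ, τ + Δ]` (the ledger of block `h` is delivered), then during `δ` after each honest proof, and
for another `Δ` after the `L`-th one (the ledger of block `h + 1` is delivered). Thus, once
`votes = L`, the field `resume` is the time `τ_c` at which the ledger of block `h` is confirmed. -/
def confState (P : Params) (m : MiningPath) : ℕ → ConfState
  | 0 => ⟨0, tau P m + P.Δ⟩
  | n + 1 =>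
    let s := confState P m n
    if preCount P m < n + 1 ∧ s.votes < P.L ∧ m.byHonest (n + 1) = true ∧
        s.resume < m.time (n + 1) then
      ⟨s.votes + 1, m.time (n + 1) + P.δ + if s.votes + 1 = P.L then P.Δ else 0⟩
    else s

open Classical in
/-- The proofs that are honest in the rigged model; every other proof is adversarial, even when an
honest miner found it.
* up to `τ`: see `preHonest`;
* in the confirmation interval: found by an honest miner while honest miners are not idle;
* after `τ_c`: found by an honest miner, at least `δ` after both `τ_c` and the previous proof. -/
def IsHonest (P : Params) (m : MiningPath) (i : ℕ) : Prop :=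
  if i ≤ preCount P m then preHonest P m i
  else
    let s := confState P m (i - 1)
    m.byHonest i = true ∧
      if s.votes < P.L then s.resume < m.time i
      else max (m.time (i - 1)) s.resume + P.δ ≤ m.time i

/-! ### Proof trees, heaviest chains, ledgers -/

/-- A tree of sequential proofs. Every proof refers to one earlier proof. `vote i = none` means
that the chain ending in `i` has not left block `h` yet; `vote i = some ℓ` means that it has
started block `h + 1` and that its proofs vote for the ledger `ℓ` of block `h`. The vote is chosen
by the first proof of block `h + 1` and inherited by everything built on top of it. -/
structure ProofTree (Ledger : Type*) where
  parent : ℕ → ℕ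
  vote : ℕ → Option Ledger
  parent_lt : ∀ i, i ≠ 0 → parent i < i
  vote_genesis : vote 0 = none
  vote_inherit : ∀ i, i ≠ 0 → ∀ ℓ, vote (parent i) = some ℓ → vote i = some ℓ

variable {Ledger : Type*}

/-- Aggregate work of the chain ending in proof `i`: the number of proofs on it. -/
def ProofTree.work (t : ProofTree Ledger) : ℕ → ℕ
  | 0 => 0
  | n + 1 => t.work (t.parent (n + 1)) + 1
decreasing_by exact t.parent_lt (n + 1) (Nat.succ_ne_zero n)

open Classical in
/-- The number of votes for a ledger of block `h` on the chain ending in proof `i`. -/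
def ProofTree.voteCount (t : ProofTree Ledger) : ℕ → ℕ
  | 0 => 0
  | n + 1 => t.voteCount (t.parent (n + 1)) + if t.vote (n + 1) = none then 0 else 1
decreasing_by exact t.parent_lt (n + 1) (Nat.succ_ne_zero n)

/-- A possible view of an honest miner after `n` proofs have been mined: a set of published proofs,
closed under predecessors, that contains all honest proofs mined so far. Which adversarial proofs
have been published, and to whom, is up to the adversary. -/
structure IsView (P : Params) (m : MiningPath) (t : ProofTree Ledger) (n : ℕ) (V : Set ℕ) :
    Prop where
  genesis_mem : 0 ∈ V
  mined : ∀ i ∈ V, i ≤ n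
  parent_mem : ∀ i ∈ V, i ≠ 0 → t.parent i ∈ V
  honest_mem : ∀ i, i ≤ n → IsHonest P m i → i ∈ V

/-- Proof `j` is the tip of a heaviest chain in the view `V`. -/
def IsHeaviest (t : ProofTree Ledger) (V : Set ℕ) (j : ℕ) : Prop :=
  j ∈ V ∧ ∀ k ∈ V, t.work k ≤ t.work j

/-- The honest proofs of the tree obey the protocol: each is mined on a heaviest chain in the view
of its miner (ties are broken by the adversary), and a miner on a chain that is still in block `h`
extends block `h` until `τ` and starts block `h + 1`, by voting for some ledger, after `τ`.
Adversarial proofs are not restricted. -/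
def FollowsProtocol (P : Params) (m : MiningPath) (t : ProofTree Ledger) : Prop :=
  ∀ i, IsHonest P m i →
    (∃ V, IsView P m t (i - 1) V ∧ IsHeaviest t V (t.parent i)) ∧
    (t.vote (t.parent i) = none → (t.vote i = none ↔ i ≤ preCount P m))

/-- The ledger `ℓ` of block `h` is confirmed in some honest view held after exactly `n` proofs have
been mined and not before `τ_c`: a heaviest chain contains a complete block `h + 1`, i.e. at least
`L` votes, for `ℓ`. The condition on times says that some time `s ≥ τ_c` precedes
proof `n + 1`. -/
def ConfirmedAt (P : Params) (m : MiningPath) (t : ProofTree Ledger) (n : ℕ) (ℓ : Ledger) : Prop :=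
  (confState P m n).votes = P.L ∧ (confState P m n).resume < m.time (n + 1) ∧
    ∃ V c, IsView P m t n V ∧ IsHeaviest t V c ∧ t.vote c = some ℓ ∧ P.L ≤ t.voteCount c

/-- In some honest view held after `n` proofs, some heaviest chain does not carry the ledger `ℓ`. -/
def ReplacedAt (P : Params) (m : MiningPath) (t : ProofTree Ledger) (n : ℕ) (ℓ : Ledger) : Prop :=
  ∃ V d, IsView P m t n V ∧ IsHeaviest t V d ∧ t.vote d ≠ some ℓ

/-- A confirmed ledger of block `h` is discarded at some later time. -/
def Discarded (P : Params) (m : MiningPath) (t : ProofTree Ledger) : Prop :=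
  ∃ (ℓ : Ledger) (n₁ n₂ : ℕ), n₁ ≤ n₂ ∧ ConfirmedAt P m t n₁ ℓ ∧ ReplacedAt P m t n₂ ℓ

/-! ### Randomness -/

/-- Proofs are mined as a Poisson process of rate `lamP`, and each is found by an honest miner with
probability `β`, independently of everything else. -/
structure IsMining {Ω : Type*} [MeasurableSpace Ω] (μ : Measure Ω) (lamP : ℝ) (β : unitInterval)
    (gap : ℕ → Ω → ℝ) (byHonest : ℕ → Ω → Bool) : Prop where
  law : ∀ i, HasLaw (fun ω => (gap i ω, byHonest i ω))
    ((expMeasure lamP).prod (bernoulliMeasure true false β)) μ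
  indep : iIndepFun (fun i ω => (gap i ω, byHonest i ω)) μ

/-- The law of the sum of `n` independent random variables of law `ν`. -/
def iidSum (n : ℕ) (ν : Measure ℕ) : Measure ℕ :=
  (Measure.pi fun _ : Fin n => ν).map fun x => ∑ i, x i

/-- Negative binomial law: the number of failures before the `n`-th success. -/
def negBin (n : ℕ) (β : unitInterval) : Measure ℕ := iidSum n (geometricMeasure β)

/-- `Geo(1 - q / p)` on `{0, 1, 2, …}` with `q = 1 - p`, that is `k ↦ (1 - q / p) * (q / p) ^ k`.
For `1 / 2 < p ≤ 1` the parameter lies in `[0, 1]` and the projection does nothing. -/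
def leadLaw (p : ℝ) : Measure ℕ :=
  geometricMeasure (Set.projIcc (0 : ℝ) 1 zero_le_one (1 - (1 - p) / p))

/-- The law of `M_lead + S_L + S_{δ_L} + S_{Δ_2} + M_deficit` with independent summands. -/
def attackLaw (L : ℕ) (lamP : ℝ) (β : unitInterval) (δ Δ p : ℝ) : Measure ℕ :=
  (leadLaw p).conv <| (negBin L β).conv <|
    (iidSum L (poissonMeasure (lamP * δ).toNNReal)).conv <|
    (iidSum 2 (poissonMeasure (lamP * Δ).toNNReal)).conv (leadLaw p)

end RiggedPoW

end

/-!
The adversary's power is measured by its *lead* `x`. Up to `τ` the lead is a walk reflected at `0`,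
which grows by one with each adversarial proof and drops by one with each honest proof; after `τ`
the same walk continues without reflection.

*Combinatorics.* Each honest proof is mined on top of a chain at least as heavy as all earlier
honest proofs, so honest proofs lie on distinct levels of the tree (`FollowsProtocol.work_lt`). At
`τ` the heaviest chain exceeds some honest proof by at most the lead
(`FollowsProtocol.exists_le_lead`). Suppose that `ℓ` is confirmed, and consider the first moment at
which a heaviest chain without `ℓ` is in some view. Every honest proof mined since `τ` carries a
vote, so it is missing either on this chain or on the confirming one, and both chains reach its
level; hence the level also holds an adversarial proof (`FollowsProtocol.exists_same_work`).
Counting levels, the honest proofs since `τ` are at most the lead at `τ` plus the adversarial proofs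
since `τ`. So a confirmed ledger is discarded only if the lead is nonnegative at some time
after all `L` honest votes have been cast (`FollowsProtocol.exists_leadWalk_mem_winStates`).

*Probability.* Together with the remaining idle time of honest miners, the lead is a Markov chain
driven by the gaps and the miners of the proofs. An explicit function of its state (`walkValue`)
does not increase in mean and is at least `1` in the states just described, so its initial value
bounds the probability that they are ever reached (`measure_exists_drivenChain_mem_le`). The function is
built from mean values over random shifts of the lead (`shiftMean`), one factor for each summand of
the bound: the probability that a walk with downward drift ever gains a given height is geometric
(`hitValue_step`); idle periods contribute Poisson laws, by the renewal equation of the Poisson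
process (`shiftMean_poisson_renewal`); the proofs of the adversary before an honest miner succeeds
contribute geometric laws (`shiftMean_geometric`). Finally, the geometric law is stationary for the
reflected walk, and it dominates the lead at `τ`, whether `τ` is the time of a fixed proof or
of a fixed honest proof (`preValue_le_shiftMean_leadLaw`).
-/

noncomputable section

namespace RiggedPoW

variable {Ledger : Type*}

/-! ### The lead walk -/

/-- The state sequence of a recursion driven by the inputs `z 1, z 2, …`. -/
def drivenChain {S Z : Type*} (step : S → Z → S) (s₀ : S) (z : ℕ → Z) : ℕ → S
  | 0 => s₀
  | n + 1 => step (drivenChain step s₀ z n) (z (n + 1))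

/-- One step of the countdown to the end of the pre-mining phase; `b` tells whether the new proof
is honest. -/
def PreMining.countdown : PreMining → ℕ → Bool → ℕ
  | .afterProofs _, c, _ => c - 1
  | .afterHonest _, c, b => if b then c - 1 else c

/-- The initial value of the countdown to the end of the pre-mining phase. -/
def PreMining.start : PreMining → ℕ
  | .afterProofs n => n
  | .afterHonest k => k

open Classical in
/-- Transition of the lead walk. A state `((c, x, v), s)` consists of the number `c` of (honest)
proofs still missing in the pre-mining phase, the lead `x` of the adversary, the number `v` of
honest votes since `τ`, and the time `s` from the last proof to the end of the current idle period
of the honest miners (negative if it is over). The input is the gap before the next proof and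
whether an honest miner finds it. The lead grows by one with each adversarial proof and drops by
one with each honest proof, but it stays nonnegative in the pre-mining phase, which also keeps `v`
and `s` at the values `0` and `Δ` that they have at `τ`. -/
def walkStep (P : Params) (a : (ℕ × ℤ × ℕ) × ℝ) (z : ℝ × Bool) : (ℕ × ℤ × ℕ) × ℝ :=
  if 0 < a.1.1 then
    if z.2 = true ∧ P.δ ≤ z.1 then
      ((P.pre.countdown a.1.1 true, max (a.1.2.1 - 1) 0, 0), P.Δ)
    else ((P.pre.countdown a.1.1 false, a.1.2.1 + 1, 0), P.Δ)
  else if a.1.2.2 < P.L then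
    if z.2 = true ∧ a.2 < z.1 then
      ((0, a.1.2.1 - 1, a.1.2.2 + 1), P.δ + if a.1.2.2 + 1 = P.L then P.Δ else 0)
    else ((0, a.1.2.1 + 1, a.1.2.2), a.2 - z.1)
  else if z.2 = true ∧ max 0 a.2 + P.δ ≤ z.1 then ((0, a.1.2.1 - 1, a.1.2.2), a.2 - z.1)
  else ((0, a.1.2.1 + 1, a.1.2.2), a.2 - z.1)

/-- The lead walk along a sample path of the mining process. -/
def leadWalk (P : Params) (m : MiningPath) : ℕ → (ℕ × ℤ × ℕ) × ℝ :=
  drivenChain (walkStep P) ((P.pre.start, 0, 0), P.Δ) fun i => (m.gap i, m.byHonest i)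

/-- The states that the lead walk has to visit if a confirmed ledger is discarded: all `L` honest
votes have been cast, and the lead is nonnegative. -/
def winStates (P : Params) : Set ((ℕ × ℤ × ℕ) × ℝ) :=
  {a | a.1.1 = 0 ∧ P.L ≤ a.1.2.2 ∧ 0 ≤ a.1.2.1}

open Classical in
/-- The number of honest proofs among the first `n`, by the rule of the pre-mining phase. -/
def preHonestCount (P : Params) (m : MiningPath) (n : ℕ) : ℕ :=
  ((Finset.Icc 1 n).filter (preHonest P m)).card

/-- The pre-mining phase ends. If it does not, `preCount` has the junk value `0`. -/
def PreMiningEnds (P : Params) (m : MiningPath) : Prop :=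
  ∀ k, P.pre = .afterHonest k → ∃ n, k ≤ preHonestCount P m n

open Classical in
lemma preHonestCount_succ (P : Params) (m : MiningPath) (n : ℕ) :
    preHonestCount P m (n + 1) =
      preHonestCount P m n + if preHonest P m (n + 1) then 1 else 0 := by
  unfold preHonestCount
  rw [← Finset.insert_Icc_right_eq_Icc_add_one (by omega), Finset.filter_insert]
  split_ifs with h
  · rw [Finset.card_insert_of_notMem (by simp)]
  · rfl

lemma time_succ (m : MiningPath) (n : ℕ) : m.time (n + 1) = m.time n + m.gap (n + 1) := by
  unfold MiningPath.time
  rw [Finset.sum_Icc_succ_top (by omega)]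

lemma leadWalk_succ (P : Params) (m : MiningPath) (n : ℕ) :
    leadWalk P m (n + 1) = walkStep P (leadWalk P m n) (m.gap (n + 1), m.byHonest (n + 1)) := rfl

/-- The countdown after `n` proofs. -/
def preRemaining (P : Params) (m : MiningPath) (n : ℕ) : ℕ :=
  match P.pre with
  | .afterProofs N => N - n
  | .afterHonest k => k - preHonestCount P m n

lemma preRemaining_pos {P : Params} {m : MiningPath} {n : ℕ} (hn : n < preCount P m) :
    0 < preRemaining P m n := by
  cases hP : P.pre with
  | afterProofs N =>
    simp only [preCount, hP] at hn
    simp only [preRemaining, hP]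
    omega
  | afterHonest k =>
    simp only [preCount, hP] at hn
    simp only [preRemaining, hP]
    exact Nat.sub_pos_of_lt (not_le.1 (Nat.notMem_of_lt_sInf
      (s := {n | k ≤ preHonestCount P m n}) hn))

lemma preRemaining_preCount {P : Params} {m : MiningPath} (hm : PreMiningEnds P m) :
    preRemaining P m (preCount P m) = 0 := by
  cases hP : P.pre with
  | afterProofs N => simp [preRemaining, preCount, hP]
  | afterHonest k =>
    simp only [preRemaining, preCount, hP]
    exact Nat.sub_eq_zero_of_le
      (Nat.sInf_mem (s := {n | k ≤ preHonestCount P m n}) (hm k hP))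

open Classical in
lemma preRemaining_succ (P : Params) (m : MiningPath) (n : ℕ) :
    preRemaining P m (n + 1) =
      P.pre.countdown (preRemaining P m n) (decide (preHonest P m (n + 1))) := by
  cases hP : P.pre with
  | afterProofs N =>
    simp only [preRemaining, PreMining.countdown, hP]
    omega
  | afterHonest k =>
    simp only [preRemaining, PreMining.countdown, hP, preHonestCount_succ, decide_eq_true_eq]
    split_ifs <;> omega

/-! ### Honest proofs raise the heaviest chain -/

lemma ProofTree.work_of_ne_zero (t : ProofTree Ledger) {i : ℕ} (hi : i ≠ 0) :
    t.work i = t.work (t.parent i) + 1 := by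
  obtain ⟨n, rfl⟩ := Nat.exists_eq_succ_of_ne_zero hi
  rw [ProofTree.work]

/-- Every chain has a proof on each level up to its work, and votes are inherited from it. -/
lemma ProofTree.exists_ancestor (t : ProofTree Ledger) (j : ℕ) {w : ℕ} (hw : w ≤ t.work j) :
    ∃ a ≤ j, t.work a = w ∧ ∀ ℓ, t.vote a = some ℓ → t.vote j = some ℓ := by
  induction j using Nat.strong_induction_on with
  | _ j ih =>
    rcases hw.eq_or_lt with rfl | hlt
    · exact ⟨j, le_rfl, rfl, fun _ h => h⟩
    · have hj : j ≠ 0 := by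
        rintro rfl
        rw [ProofTree.work] at hlt
        omega
      rw [t.work_of_ne_zero hj] at hlt
      obtain ⟨a, ha, haw, hav⟩ := ih _ (t.parent_lt j hj) (Nat.lt_succ_iff.1 hlt)
      exact ⟨a, ha.trans (t.parent_lt j hj).le, haw,
        fun ℓ h => t.vote_inherit j hj ℓ (hav ℓ h)⟩

lemma FollowsProtocol.work_lt {P : Params} {m : MiningPath} {t : ProofTree Ledger}
    (ht : FollowsProtocol P m t) {a b : ℕ} (hb : IsHonest P m b) (ha : a = 0 ∨ IsHonest P m a)
    (hab : a < b) : t.work a < t.work b := by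
  obtain ⟨⟨V, hV, -, hmax⟩, -⟩ := ht b hb
  have haV : a ∈ V := by
    rcases ha with rfl | ha
    · exact hV.genesis_mem
    · exact hV.honest_mem a (by omega) ha
  rw [t.work_of_ne_zero (i := b) (by omega)]
  exact Nat.lt_succ_of_le (hmax a haV)

lemma FollowsProtocol.eq_of_work_eq {P : Params} {m : MiningPath} {t : ProofTree Ledger}
    (ht : FollowsProtocol P m t) {a b : ℕ} (ha : IsHonest P m a) (hb : IsHonest P m b)
    (h : t.work a = t.work b) : a = b := by
  rcases lt_trichotomy a b with hab | hab | hab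
  · exact absurd h (ht.work_lt hb (.inr ha) hab).ne
  · exact hab
  · exact absurd h (ht.work_lt ha (.inr hb) hab).ne'

/-- In the pre-mining phase, the lead bounds how far the heaviest chain exceeds an honest proof. -/
lemma FollowsProtocol.exists_le_lead {P : Params} {m : MiningPath} {t : ProofTree Ledger}
    (ht : FollowsProtocol P m t) {n : ℕ} (hn : n ≤ preCount P m) :
    ∃ x : ℕ, leadWalk P m n = ((preRemaining P m n, (x : ℤ), 0), P.Δ) ∧
      ∃ h ≤ n, (h = 0 ∨ IsHonest P m h) ∧ ∀ j ≤ n, t.work j ≤ t.work h + x := by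
  classical
  induction n with
  | zero =>
    refine ⟨0, ?_, 0, le_rfl, .inl rfl, fun j hj => by simp [Nat.le_zero.1 hj]⟩
    simp only [leadWalk, drivenChain, preRemaining, PreMining.start]
    split <;> simp [preHonestCount]
  | succ n ih =>
    obtain ⟨x, hx, h, hhn, hh, hmax⟩ := ih (by omega)
    have hpos := preRemaining_pos (P := P) (m := m) (n := n) (by omega)
    have hiff : preHonest P m (n + 1) ↔ m.byHonest (n + 1) = true ∧ P.δ ≤ m.gap (n + 1) := by
      simp [preHonest]
    have hIs : IsHonest P m (n + 1) ↔ preHonest P m (n + 1) := by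
      rw [IsHonest, if_pos hn]
    rw [leadWalk_succ, hx, preRemaining_succ]
    simp only [walkStep, if_pos hpos, ← hiff]
    by_cases hc : preHonest P m (n + 1)
    · refine ⟨x - 1, ?_, n + 1, le_rfl, .inr (hIs.2 hc), fun j hj => ?_⟩
      · simp [hc]
        omega
      · have := ht.work_lt (hIs.2 hc) hh (by omega)
        rcases hj.eq_or_lt with rfl | hj
        · omega
        · have := hmax j (by omega)
          omega
    · refine ⟨x + 1, by simp [hc], h, by omega, hh, fun j hj => ?_⟩
      rcases hj.eq_or_lt with rfl | hj
      · rw [t.work_of_ne_zero (by omega)]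
        have := hmax (t.parent (n + 1)) (Nat.lt_succ_iff.1 (t.parent_lt _ (by omega)))
        omega
      · have := hmax j (by omega)
        omega

lemma confState_of_le {P : Params} {m : MiningPath} {n : ℕ} (hn : n ≤ preCount P m) :
    confState P m n = ⟨0, tau P m + P.Δ⟩ := by
  induction n with
  | zero => rfl
  | succ n ih =>
    rw [confState, if_neg (by omega), ih (by omega)]

open Classical in
/-- From `τ` on, the lead walk counts the adversarial minus the honest proofs, and carries the state
of the confirmation interval. -/
lemma leadWalk_of_preCount_le {P : Params} {m : MiningPath} (hm : PreMiningEnds P m) {x : ℤ}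
    (hx : leadWalk P m (preCount P m) = ((preRemaining P m (preCount P m), x, 0), P.Δ)) {n : ℕ}
    (hn : preCount P m ≤ n) :
    leadWalk P m n = ((0, x + ((Finset.Ioc (preCount P m) n).filter (¬ IsHonest P m ·)).card -
      ((Finset.Ioc (preCount P m) n).filter (IsHonest P m)).card, (confState P m n).votes),
      (confState P m n).resume - m.time n) := by
  induction n, hn using Nat.le_induction with
  | base => simp [hx, preRemaining_preCount hm, confState_of_le le_rfl, tau]
  | succ n hn ih =>
    rw [leadWalk_succ, ih, ← Finset.insert_Ioc_right_eq_Ioc_add_one hn, Finset.filter_insert,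
      Finset.filter_insert]
    have hH : IsHonest P m (n + 1) ↔ m.byHonest (n + 1) = true ∧
        if (confState P m n).votes < P.L then (confState P m n).resume < m.time (n + 1)
        else max (m.time n) (confState P m n).resume + P.δ ≤ m.time (n + 1) := by
      rw [IsHonest, if_neg (by omega)]
      simp
    have h1 : (confState P m n).resume - m.time n < m.gap (n + 1) ↔
        (confState P m n).resume < m.time (n + 1) := by
      rw [time_succ, sub_lt_iff_lt_add']
    have h2 : max 0 ((confState P m n).resume - m.time n) + P.δ ≤ m.gap (n + 1) ↔
        max (m.time n) (confState P m n).resume + P.δ ≤ m.time (n + 1) := by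
      have : max (m.time n) (confState P m n).resume =
          max 0 ((confState P m n).resume - m.time n) + m.time n := by
        rw [max_add, zero_add, sub_add_cancel]
      rw [time_succ, this]
      constructor <;> intro <;> linarith
    simp only [walkStep, lt_irrefl, if_false, h1, h2, confState, Nat.lt_succ_of_le hn, true_and]
    by_cases hH' : IsHonest P m (n + 1)
    · have hH2 := hH.1 hH'
      by_cases hv : (confState P m n).votes < P.L
      · rw [if_pos hv] at hH2
        simp [hH', hv, hH2]
        constructor <;> ring
      · rw [if_neg hv] at hH2
        simp [hH', hv, hH2]
        rw [time_succ]
        constructor <;> ring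
    · have hH2 := mt hH.2 hH'
      by_cases hv : (confState P m n).votes < P.L
      · rw [if_pos hv] at hH2
        simp only [hH', hv, hH2, if_true, if_false, true_and, not_false_eq_true]
        simp [time_succ]
        constructor <;> ring
      · rw [if_neg hv] at hH2
        simp only [hH', hv, hH2, if_true, if_false, false_and, not_false_eq_true]
        simp [time_succ]
        constructor <;> ring

lemma confState_votes_mono (P : Params) (m : MiningPath) {n n' : ℕ} (h : n ≤ n') :
    (confState P m n).votes ≤ (confState P m n').votes := by
  refine monotone_nat_of_le_succ (f := fun n => (confState P m n).votes) (fun n => ?_) h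
  simp only [confState]
  split_ifs <;> simp

/-- If `ℓ` is confirmed after `n₁` proofs and `n₂` is the first later moment at which it can be
replaced, then every honest proof since `τ` shares its level with an adversarial proof: it is not on
the chain replacing `ℓ` if it votes for `ℓ`, and not on the confirming chain otherwise. -/
lemma FollowsProtocol.exists_same_work {P : Params} {m : MiningPath} {t : ProofTree Ledger}
    (ht : FollowsProtocol P m t) {ℓ : Ledger} {n₁ n₂ : ℕ} (hn : n₁ ≤ n₂)
    (hc : ConfirmedAt P m t n₁ ℓ) (hr : ReplacedAt P m t n₂ ℓ)
    (hmin : ∀ n, n₁ ≤ n → n < n₂ → ¬ ReplacedAt P m t n ℓ) {i : ℕ} (hi : IsHonest P m i)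
    (hi1 : preCount P m < i) (hi2 : i ≤ n₂) :
    ∃ a ≤ n₂, t.work a = t.work i ∧ ¬ IsHonest P m a := by
  have key : ∀ j ≤ n₂, t.work i ≤ t.work j → (∀ ℓ', t.vote i = some ℓ' → t.vote j ≠ some ℓ') →
      ∃ a ≤ n₂, t.work a = t.work i ∧ ¬ IsHonest P m a := by
    intro j hj hw hv
    obtain ⟨a, ha, haw, hav⟩ := t.exists_ancestor j hw
    refine ⟨a, ha.trans hj, haw, fun haH => ?_⟩
    obtain rfl := ht.eq_of_work_eq haH hi haw
    obtain ⟨⟨-, -⟩, h2⟩ := ht a hi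
    have hne : t.vote a ≠ none := by
      cases hp : t.vote (t.parent a) with
      | none => exact fun h => absurd ((h2 hp).1 h) (by omega)
      | some ℓ' => simp [t.vote_inherit a (by omega) ℓ' hp]
    obtain ⟨ℓ', hℓ'⟩ := Option.ne_none_iff_exists'.1 hne
    exact hv ℓ' hℓ' (hav ℓ' hℓ')
  obtain ⟨-, -, V, c, hV, hcH, hcv, -⟩ := hc
  obtain ⟨V', d, hV', hdH, hdv⟩ := hr
  by_cases hvi : t.vote i = some ℓ
  · refine key d (hV'.mined d hdH.1) (hdH.2 i (hV'.honest_mem i hi2 hi)) fun ℓ' h => ?_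
    rw [hvi] at h
    rwa [← h]
  · by_cases hin : i ≤ n₁
    · refine key c ((hV.mined c hcH.1).trans hn) (hcH.2 i (hV.honest_mem i hin hi))
        fun ℓ' h h' => ?_
      rw [hcv] at h'
      exact hvi (h.trans h'.symm)
    · -- the miner of `i` already sees a heaviest chain without `ℓ`, against the choice of `n₂`
      obtain ⟨⟨V'', hV'', hH''⟩, -⟩ := ht i hi
      refine absurd ⟨V'', _, hV'', hH'', fun h => hvi (t.vote_inherit i (by omega) ℓ h)⟩
        (hmin (i - 1) (by omega) (by omega))

/-- A confirmed ledger is discarded only if the lead walk visits `winStates`. -/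
theorem FollowsProtocol.exists_leadWalk_mem_winStates {P : Params} (hL : 1 ≤ P.L)
    {m : MiningPath} {t : ProofTree Ledger} (ht : FollowsProtocol P m t) (hm : PreMiningEnds P m)
    (hd : Discarded P m t) : ∃ n, leadWalk P m n ∈ winStates P := by
  classical
  obtain ⟨ℓ, n₁, n, hn, hc, hr⟩ := hd
  have hex : ∃ n, n₁ ≤ n ∧ ReplacedAt P m t n ℓ := ⟨n, hn, hr⟩
  obtain ⟨hn₂, hr₂⟩ := Nat.find_spec hex
  have hmin : ∀ k, n₁ ≤ k → k < Nat.find hex → ¬ ReplacedAt P m t k ℓ :=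
    fun k hk hlt h => Nat.find_min hex hlt ⟨hk, h⟩
  set n₂ := Nat.find hex
  have hpre : preCount P m ≤ n₂ := by
    by_contra! hlt
    have := hc.1
    rw [confState_of_le (by omega)] at this
    exact absurd this (by simp; omega)
  obtain ⟨x, hx, h, hhn, hh, hmax⟩ := ht.exists_le_lead le_rfl
  refine ⟨n₂, ?_⟩
  rw [leadWalk_of_preCount_le hm hx hpre]
  refine ⟨rfl, hc.1.symm.le.trans (confState_votes_mono P m hn₂), ?_⟩
  set I := Finset.Ioc (preCount P m) n₂
  -- the levels of the honest proofs lie below the lead or are hit by adversarial proofs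
  have hsub : (I.filter (IsHonest P m)).image t.work ⊆
      Finset.Ioc (t.work h) (t.work h + x) ∪ (I.filter (¬ IsHonest P m ·)).image t.work := by
    intro w hw
    obtain ⟨i, hi, rfl⟩ := Finset.mem_image.1 hw
    obtain ⟨hiI, hiH⟩ := Finset.mem_filter.1 hi
    obtain ⟨hi1, hi2⟩ := Finset.mem_Ioc.1 hiI
    obtain ⟨a, ha, haw, haH⟩ := ht.exists_same_work hn₂ hc hr₂ hmin hiH hi1 hi2
    rw [Finset.mem_union]
    by_cases hap : a ≤ preCount P m
    · left
      exact Finset.mem_Ioc.2 ⟨ht.work_lt hiH hh (by omega), haw ▸ hmax a hap⟩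
    · right
      rw [← haw]
      exact Finset.mem_image_of_mem _
        (Finset.mem_filter.2 ⟨Finset.mem_Ioc.2 ⟨by omega, ha⟩, haH⟩)
  have hcard := (Finset.card_le_card hsub).trans (Finset.card_union_le _ _)
  rw [Finset.card_image_of_injOn fun a ha b hb hab => ht.eq_of_work_eq
    (Finset.mem_filter.1 ha).2 (Finset.mem_filter.1 hb).2 hab, Nat.card_Ioc,
    Nat.add_sub_cancel_left] at hcard
  have := hcard.trans (Nat.add_le_add_left Finset.card_image_le _)
  simp only
  omega

/-! ### A maximal inequality for chains driven by independent inputs -/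

section Chain

variable {Ω S Z : Type*} [MeasurableSpace S] [mZ : MeasurableSpace Z] {step : S → Z → S}

lemma measurable_drivenChain_iSup_comap (hstep : Measurable (Function.uncurry step)) (s₀ : S)
    (z : ℕ → Ω → Z) (n : ℕ) :
    Measurable[⨆ i ∈ Set.Iic n, mZ.comap (z i)]
      fun ω => drivenChain step s₀ (fun i => z i ω) n := by
  induction n with
  | zero => exact @measurable_const _ _ _ (_) _
  | succ n ih =>
    have h1 : Measurable[⨆ i ∈ Set.Iic (n + 1), mZ.comap (z i)]
        fun ω => drivenChain step s₀ (fun i => z i ω) n :=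
      ih.mono (biSup_mono fun i hi => Set.mem_Iic.2 ((Set.mem_Iic.1 hi).trans n.le_succ)) le_rfl
    have h2 : Measurable[⨆ i ∈ Set.Iic (n + 1), mZ.comap (z i)] (z (n + 1)) :=
      measurable_iff_comap_le.2 (le_iSup₂_of_le (n + 1) (Set.mem_Iic.2 le_rfl) le_rfl)
    exact hstep.comp (h1.prodMk h2)

variable [MeasurableSpace Ω] {μ : Measure Ω} {z : ℕ → Ω → Z}

lemma measurable_drivenChain (hstep : Measurable (Function.uncurry step)) (s₀ : S)
    (hz : ∀ i, Measurable (z i)) (n : ℕ) :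
    Measurable fun ω => drivenChain step s₀ (fun i => z i ω) n :=
  (measurable_drivenChain_iSup_comap hstep s₀ z n).mono
    (iSup₂_le fun i _ => (hz i).comap_le) le_rfl

lemma indepFun_drivenChain (hstep : Measurable (Function.uncurry step)) (s₀ : S)
    (hz : ∀ i, Measurable (z i)) (hind : iIndepFun z μ) (n : ℕ) :
    IndepFun (fun ω => drivenChain step s₀ (fun i => z i ω) n) (z (n + 1)) μ := by
  have h := indep_iSup_of_disjoint (fun i => (hz i).comap_le) hind.iIndep
    (S := Set.Iic n) (T := {n + 1}) (by simp)
  rw [IndepFun_iff_Indep]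
  refine indep_of_indep_of_le_right (indep_of_indep_of_le_left h
    (measurable_drivenChain_iSup_comap hstep s₀ z n).comap_le) ?_
  simp

/-- If `V` does not increase in mean along the chain, then `V` of the chain is a supermartingale. -/
lemma lintegral_drivenChain_le [IsProbabilityMeasure μ]
    (hstep : Measurable (Function.uncurry step)) (s₀ : S)
    (hz : ∀ i, Measurable (z i)) (hind : iIndepFun z μ) {ν : Measure Z} [SFinite ν]
    (hlaw : ∀ i, μ.map (z i) = ν) {V : S → ENNReal} (hV : Measurable V)
    (hVstep : ∀ a, ∫⁻ y, V (step a y) ∂ν ≤ V a) (n : ℕ) :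
    ∫⁻ ω, V (drivenChain step s₀ (fun i => z i ω) n) ∂μ ≤ V s₀ := by
  induction n with
  | zero => simp [drivenChain]
  | succ n ih =>
    refine le_trans ?_ ih
    have hm := measurable_drivenChain hstep s₀ hz n
    have hmap := (indepFun_iff_map_prod_eq_prod_map_map hm.aemeasurable (hz (n + 1)).aemeasurable).1
      (indepFun_drivenChain hstep s₀ hz hind n)
    rw [hlaw] at hmap
    have hVs : Measurable fun q : S × Z => V (step q.1 q.2) := hV.comp hstep
    calc ∫⁻ ω, V (drivenChain step s₀ (fun i => z i ω) (n + 1)) ∂μ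
        = ∫⁻ q, V (step q.1 q.2)
            ∂(μ.map fun ω => (drivenChain step s₀ (fun i => z i ω) n, z (n + 1) ω)) := by
          rw [lintegral_map hVs (hm.prodMk (hz (n + 1)))]
          rfl
      _ = ∫⁻ ω, ∫⁻ y, V (step (drivenChain step s₀ (fun i => z i ω) n) y) ∂ν ∂μ := by
          rw [hmap, lintegral_prod _ hVs.aemeasurable, lintegral_map _ hm]
          exact hVs.lintegral_prod_right'
      _ ≤ _ := lintegral_mono fun ω => hVstep _

/-- If `V` is at least `1` on `B` and does not increase in mean outside `B`, then the chain visits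
`B` with probability at most `V s₀`. -/
theorem measure_exists_drivenChain_mem_le [IsProbabilityMeasure μ]
    (hstep : Measurable (Function.uncurry step)) (s₀ : S)
    (hz : ∀ i, Measurable (z i)) (hind : iIndepFun z μ) {ν : Measure Z} [IsProbabilityMeasure ν]
    (hlaw : ∀ i, μ.map (z i) = ν) {V : S → ENNReal} (hV : Measurable V) {B : Set S}
    (hB : MeasurableSet B) (hVB : ∀ a ∈ B, 1 ≤ V a)
    (hVstep : ∀ a ∉ B, ∫⁻ y, V (step a y) ∂ν ≤ V a) :
    μ {ω | ∃ n, drivenChain step s₀ (fun i => z i ω) n ∈ B} ≤ V s₀ := by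
  classical
  -- the chain stopped on its first visit to `B`
  set step' : S → Z → S := fun a y => if a ∈ B then a else step a y
  have hpos : ∀ a ∈ B, ∀ y, step' a y = a := fun a ha y => if_pos ha
  have hneg : ∀ a ∉ B, ∀ y, step' a y = step a y := fun a ha y => if_neg ha
  have hstep'm : Measurable (Function.uncurry step') :=
    Measurable.ite (measurable_fst hB) measurable_fst hstep
  have hV' : ∀ a, ∫⁻ y, V (step' a y) ∂ν ≤ V a := by
    intro a
    by_cases ha : a ∈ B
    · simp [hpos a ha]
    · simpa [hneg a ha] using hVstep a ha
  set A : ℕ → Set Ω := fun n => {ω | drivenChain step' s₀ (fun i => z i ω) n ∈ B}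
  have hAmono : Monotone A := monotone_nat_of_le_succ fun n ω hω => by
    have hω' : drivenChain step' s₀ (fun i => z i ω) n ∈ B := hω
    change drivenChain step' s₀ (fun i => z i ω) (n + 1) ∈ B
    rwa [drivenChain, hpos _ hω']
  have hcase : ∀ ω n, drivenChain step' s₀ (fun i => z i ω) n ∈ B ∨
      drivenChain step' s₀ (fun i => z i ω) n = drivenChain step s₀ (fun i => z i ω) n := by
    intro ω n
    induction n with
    | zero => exact .inr rfl
    | succ n ih =>
      by_cases h : drivenChain step' s₀ (fun i => z i ω) n ∈ B
      · exact .inl (hAmono n.le_succ h)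
      · right
        rw [drivenChain, drivenChain, ← ih.resolve_left h, hneg _ h]
  have hsub : {ω | ∃ n, drivenChain step s₀ (fun i => z i ω) n ∈ B} ⊆ ⋃ n, A n := by
    rintro ω ⟨n, hn⟩
    refine Set.mem_iUnion.2 ⟨n, ?_⟩
    rcases hcase ω n with h | h
    · exact h
    · change drivenChain step' s₀ (fun i => z i ω) n ∈ B
      rwa [h]
  refine (measure_mono hsub).trans ?_
  rw [hAmono.measure_iUnion]
  refine iSup_le fun n => ?_
  refine le_trans ?_ (lintegral_drivenChain_le hstep'm s₀ hz hind hlaw hV hV' n)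
  have hAm : MeasurableSet (A n) := measurable_drivenChain hstep'm s₀ hz n hB
  rw [← lintegral_indicator_one hAm]
  refine lintegral_mono fun ω => ?_
  by_cases hω : ω ∈ A n
  · simpa [hω] using hVB _ hω
  · simp [hω]

end Chain

/-! ### Averages over random integer shifts -/

/-- The mean of `F (x + N)` for a random variable `N` of law `ν`. -/
def shiftMean (ν : Measure ℕ) (F : ℤ → ENNReal) (x : ℤ) : ENNReal := ∫⁻ k, F (x + k) ∂ν

lemma shiftMean_conv (ν ν' : Measure ℕ) [SFinite ν'] (F : ℤ → ENNReal) :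
    shiftMean (ν.conv ν') F = shiftMean ν (shiftMean ν' F) := by
  ext x
  simp only [shiftMean]
  rw [Measure.lintegral_conv .of_discrete]
  simp only [Nat.cast_add, add_assoc]

lemma shiftMean_comm (ν ν' : Measure ℕ) [SFinite ν] [SFinite ν'] (F : ℤ → ENNReal) :
    shiftMean ν (shiftMean ν' F) = shiftMean ν' (shiftMean ν F) := by
  rw [← shiftMean_conv, Measure.conv_comm, shiftMean_conv]

lemma shiftMean_dirac_zero (F : ℤ → ENNReal) : shiftMean (Measure.dirac 0) F = F := by
  ext x
  simp [shiftMean]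

lemma shiftMean_translate (ν : Measure ℕ) (F : ℤ → ENNReal) (a : ℤ) :
    shiftMean ν (fun y => F (y - a)) = fun x => shiftMean ν F (x - a) := by
  ext x
  simp only [shiftMean, sub_add_eq_add_sub]

lemma monotone_shiftMean (ν : Measure ℕ) {F : ℤ → ENNReal} (h : Monotone F) :
    Monotone (shiftMean ν F) := fun _ _ hxy => lintegral_mono fun _ => h (by omega)

lemma le_shiftMean (ν : Measure ℕ) [IsProbabilityMeasure ν] {F : ℤ → ENNReal} (h : Monotone F)
    (x : ℤ) : F x ≤ shiftMean ν F x := by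
  calc F x = ∫⁻ _, F x ∂ν := by simp
    _ ≤ _ := lintegral_mono fun k => h (by omega)

lemma shiftMean_le_one (ν : Measure ℕ) [IsProbabilityMeasure ν] {F : ℤ → ENNReal}
    (h : ∀ x, F x ≤ 1) (x : ℤ) : shiftMean ν F x ≤ 1 := by
  calc shiftMean ν F x ≤ ∫⁻ _, 1 ∂ν := lintegral_mono fun k => h _
    _ = 1 := by simp

instance (n : ℕ) (ν : Measure ℕ) [IsProbabilityMeasure ν] : IsProbabilityMeasure (iidSum n ν) :=
  Measure.isProbabilityMeasure_map Measurable.of_discrete.aemeasurable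

lemma iidSum_zero (ν : Measure ℕ) [IsProbabilityMeasure ν] : iidSum 0 ν = Measure.dirac 0 := by
  simp [iidSum, Measure.map_const]

lemma iidSum_succ (n : ℕ) (ν : Measure ℕ) [IsProbabilityMeasure ν] :
    iidSum (n + 1) ν = ν.conv (iidSum n ν) := by
  have h := (measurePreserving_piFinSuccAbove (fun _ : Fin (n + 1) => ν) 0).map_eq
  have hs : Measurable fun x : Fin n → ℕ => ∑ i, x i := .of_discrete
  have hp := Measure.map_prod_map ν (Measure.pi fun _ : Fin n => ν) measurable_id hs
  rw [Measure.map_id] at hp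
  rw [iidSum, iidSum, Measure.conv, hp, ← h, Measure.map_map (by fun_prop) (by fun_prop),
    Measure.map_map (by fun_prop) (by fun_prop)]
  congr 1
  ext x
  simp [Fin.sum_univ_succ, Fin.tail]

lemma shiftMean_geometric {β : unitInterval} (hβ : β ≠ 0) (F : ℤ → ENNReal) (x : ℤ) :
    shiftMean (geometricMeasure β) F x = ENNReal.ofReal β * F x +
      ENNReal.ofReal (1 - β) * shiftMean (geometricMeasure β) F (x + 1) := by
  simp only [shiftMean, geometricMeasure_eq hβ, lintegral_sum_measure, lintegral_smul_measure,
    lintegral_dirac, smul_eq_mul]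
  rw [tsum_eq_zero_add' ENNReal.summable, ← ENNReal.tsum_mul_left]
  congr 1
  · simp
  · refine tsum_congr fun n => ?_
    have h1 : (0 : ℝ) ≤ 1 - β := sub_nonneg.2 β.2.2
    rw [← mul_assoc, ← ENNReal.ofReal_mul h1]
    congr 2
    · ring
    · push_cast
      ring

lemma shiftMean_poisson (r : NNReal) (F : ℤ → ENNReal) (x : ℤ) :
    shiftMean (poissonMeasure r) F x =
      ∑' k : ℕ, ENNReal.ofReal (Real.exp (-r) * r ^ k / k.factorial) * F (x + k) := by
  simp only [shiftMean, poissonMeasure, lintegral_sum_measure, lintegral_smul_measure,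
    lintegral_dirac, smul_eq_mul]

lemma shiftMean_poisson_zero (F : ℤ → ENNReal) : shiftMean (poissonMeasure 0) F = F := by
  ext x
  rw [shiftMean_poisson, tsum_eq_single 0]
  · simp
  · intro k hk
    simp [hk]

lemma shiftMean_poisson_add {r s : ℝ} (hr : 0 ≤ r) (hs : 0 ≤ s) (F : ℤ → ENNReal) :
    shiftMean (poissonMeasure (r + s).toNNReal) F =
      shiftMean (poissonMeasure r.toNNReal) (shiftMean (poissonMeasure s.toNNReal) F) := by
  rw [Real.toNNReal_add hr hs, ← poissonMeasure_conv_poissonMeasure]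
  exact shiftMean_conv _ _ F

lemma measurable_shiftMean_poisson {f : ℝ → ℝ} (hf : Measurable f) (F : ℤ → ENNReal) (x : ℤ) :
    Measurable fun s => shiftMean (poissonMeasure (f s).toNNReal) F x := by
  simp only [shiftMean_poisson]
  fun_prop

/-! ### One step of the mining process -/

lemma expMeasure_Iio_zero (lam : ℝ) : expMeasure lam (Set.Iio 0) = 0 := by
  rw [expMeasure, gammaMeasure, withDensity_apply _ measurableSet_Iio]
  exact lintegral_exponentialPDF_of_nonpos le_rfl

lemma expMeasure_singleton (lam a : ℝ) : expMeasure lam {a} = 0 :=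
  withDensity_absolutelyContinuous _ _ (by simp)

lemma expMeasure_Ici {lam a : ℝ} (hlam : 0 < lam) (ha : 0 ≤ a) :
    expMeasure lam (Set.Ici a) = ENNReal.ofReal (Real.exp (-(lam * a))) := by
  have := isProbabilityMeasure_expMeasure hlam
  have h1 : expMeasure lam (Set.Iio a) = ENNReal.ofReal (1 - Real.exp (-(lam * a))) := by
    have h2 : expMeasure lam (Set.Iic a) = ENNReal.ofReal (1 - Real.exp (-(lam * a))) := by
      rw [expMeasure, gammaMeasure, withDensity_apply _ measurableSet_Iic]
      exact (lintegral_exponentialPDF_eq_antiDeriv hlam a).trans (by rw [if_pos ha])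
    rw [← h2, ← Set.Iio_union_right]
    refine le_antisymm (measure_mono Set.subset_union_left) ?_
    refine (measure_union_le _ _).trans ?_
    simp [expMeasure_singleton]
  have h3 : Real.exp (-(lam * a)) ≤ 1 := Real.exp_le_one_iff.2 (by nlinarith)
  rw [← Set.compl_Iio, prob_compl_eq_one_sub measurableSet_Iio, h1, ← ENNReal.ofReal_one,
    ← ENNReal.ofReal_sub _ (by linarith)]
  congr 1
  ring

lemma setLIntegral_Iio_expMeasure (lam : ℝ) {s : ℝ} (hs : 0 ≤ s) {h : ℝ → ENNReal}
    (hh : Measurable h) :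
    ∫⁻ g in Set.Iio s, h g ∂expMeasure lam =
      ∫⁻ g in Set.Ioc 0 s, ENNReal.ofReal (lam * Real.exp (-(lam * g))) * h g := by
  rw [← Set.Iio_union_Ico_eq_Iio hs, lintegral_union (A := Set.Iio 0) measurableSet_Ico
    (Set.disjoint_left.2 fun g h1 h2 => absurd h1 (not_lt.2 h2.1)),
    setLIntegral_measure_zero _ _ (expMeasure_Iio_zero lam), zero_add,
    expMeasure, gammaMeasure,
    setLIntegral_withDensity_eq_setLIntegral_mul _
      (f := gammaPDF 1 lam) (measurable_exponentialPDFReal lam).ennreal_ofReal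
      hh measurableSet_Ico, setLIntegral_congr Ico_ae_eq_Ioc]
  refine setLIntegral_congr_fun measurableSet_Ioc fun g hg => ?_
  simp only [Pi.mul_apply]
  congr 1
  exact exponentialPDF_of_nonneg hg.1.le

/-- The probability of `k + 1` arrivals up to time `s`, by conditioning on the first of them. -/
lemma setLIntegral_Iio_expMeasure_poisson {lam s : ℝ} (hlam : 0 < lam) (hs : 0 ≤ s) (k : ℕ) :
    ∫⁻ g in Set.Iio s, ENNReal.ofReal (Real.exp (-((lam * (s - g)).toNNReal : ℝ)) *
        ((lam * (s - g)).toNNReal : ℝ) ^ k / k.factorial) ∂expMeasure lam =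
      ENNReal.ofReal (Real.exp (-((lam * s).toNNReal : ℝ)) *
        ((lam * s).toNNReal : ℝ) ^ (k + 1) / (k + 1).factorial) := by
  rw [setLIntegral_Iio_expMeasure lam hs (by fun_prop), Real.coe_toNNReal _ (by positivity)]
  have h1 : ∀ g ∈ Set.Ioc 0 s, ENNReal.ofReal (lam * Real.exp (-(lam * g))) *
      ENNReal.ofReal (Real.exp (-((lam * (s - g)).toNNReal : ℝ)) *
        ((lam * (s - g)).toNNReal : ℝ) ^ k / k.factorial) =
      ENNReal.ofReal (Real.exp (-(lam * s)) * lam * (lam * (s - g)) ^ k / k.factorial) := by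
    intro g hg
    rw [Real.coe_toNNReal _ (mul_nonneg hlam.le (sub_nonneg.2 hg.2)),
      ← ENNReal.ofReal_mul (by positivity)]
    have : Real.exp (-(lam * s)) = Real.exp (-(lam * g)) * Real.exp (-(lam * (s - g))) := by
      rw [← Real.exp_add]
      ring_nf
    rw [this]
    ring_nf
  rw [setLIntegral_congr_fun measurableSet_Ioc h1]
  have hcont : Continuous fun g : ℝ =>
      Real.exp (-(lam * s)) * lam * (lam * (s - g)) ^ k / k.factorial := by fun_prop
  rw [← ofReal_integral_eq_lintegral_ofReal, ← intervalIntegral.integral_of_le hs]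
  · congr 1
    have hderiv : ∀ g ∈ Set.uIcc 0 s, HasDerivAt
        (fun g => -(Real.exp (-(lam * s)) * (lam * (s - g)) ^ (k + 1) / (k + 1).factorial))
        (Real.exp (-(lam * s)) * lam * (lam * (s - g)) ^ k / k.factorial) g := by
      intro g _
      have h2 : HasDerivAt (fun g => lam * (s - g)) (lam * (-1)) g :=
        ((hasDerivAt_id g).const_sub s).const_mul lam
      convert! (((h2.pow (k + 1)).const_mul (Real.exp (-(lam * s)))).div_const
        ((k + 1).factorial : ℝ)).neg using 1
      rw [Nat.factorial_succ]
      push_cast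
      field_simp
    rw [intervalIntegral.integral_eq_sub_of_hasDerivAt hderiv (hcont.intervalIntegrable _ _)]
    simp
  · exact (hcont.integrableOn_Icc (a := 0) (b := s)).mono_set Set.Ioc_subset_Icc_self
  · refine (ae_restrict_iff' measurableSet_Ioc).2 (.of_forall fun g hg => ?_)
    have := mul_nonneg hlam.le (sub_nonneg.2 hg.2)
    simp only [Pi.zero_apply]
    positivity

/-- The renewal equation of the Poisson process: either there is no arrival up to time `s`, or the
process starts afresh at the first arrival. -/
lemma shiftMean_poisson_renewal {lam s : ℝ} (hlam : 0 < lam) (hs : 0 ≤ s) (F : ℤ → ENNReal)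
    (x : ℤ) :
    shiftMean (poissonMeasure (lam * s).toNNReal) F x =
      ENNReal.ofReal (Real.exp (-(lam * s))) * F x +
      ∫⁻ g in Set.Iio s, shiftMean (poissonMeasure (lam * (s - g)).toNNReal) F (x + 1)
        ∂expMeasure lam := by
  simp only [shiftMean_poisson]
  rw [lintegral_tsum fun k => by fun_prop, tsum_eq_zero_add' ENNReal.summable]
  congr 1
  · simp [Real.coe_toNNReal _ (mul_nonneg hlam.le hs)]
  · refine tsum_congr fun k => ?_
    rw [lintegral_mul_const _ (by fun_prop), setLIntegral_Iio_expMeasure_poisson hlam hs]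
    push_cast
    ring_nf

/-- The law of the gap before a proof, and of whether an honest miner finds it. -/
def proofLaw (lam : ℝ) (β : unitInterval) : Measure (ℝ × Bool) :=
  (expMeasure lam).prod (bernoulliMeasure true false β)

lemma isProbabilityMeasure_proofLaw {lam : ℝ} (hlam : 0 < lam) (β : unitInterval) :
    IsProbabilityMeasure (proofLaw lam β) := by
  have := isProbabilityMeasure_expMeasure hlam
  unfold proofLaw
  infer_instance

lemma bernoulliMeasure_true (β : unitInterval) :
    bernoulliMeasure true false β {true} = ENNReal.ofReal β := by
  rw [bernoulliMeasure_apply_of_mem_of_notMem _ (by simp) (by simp) (by simp), ENNReal.ofReal]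
  congr 1
  ext
  simp [Real.coe_toNNReal _ β.2.1]

lemma proofLaw_honest {lam a : ℝ} (hlam : 0 < lam) (β : unitInterval) (ha : 0 ≤ a) :
    proofLaw lam β {z | z.2 = true ∧ a ≤ z.1} =
      ENNReal.ofReal (β * Real.exp (-(lam * a))) := by
  have : {z : ℝ × Bool | z.2 = true ∧ a ≤ z.1} = Set.Ici a ×ˢ {true} := by
    ext z
    simp [and_comm]
  rw [this, proofLaw, Measure.prod_prod, expMeasure_Ici hlam ha, bernoulliMeasure_true,
    ← ENNReal.ofReal_mul (Real.exp_pos _).le, mul_comm]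

/-- One step of the lead walk while honest miners are idle for the next `s` time units, and where
the next proof is honest if it comes at least `d` after the idle period. Adversarial proofs in the
idle period raise the lead, and `X` is the value after an honest proof. -/
lemma lintegral_proofLaw_le {lam s d : ℝ} (hlam : 0 < lam) (hd : 0 ≤ d) (β : unitInterval)
    (F : ℤ → ENNReal) (x : ℤ) (X : ENNReal)
    (hX : ENNReal.ofReal (β * Real.exp (-(lam * d))) * X +
      ENNReal.ofReal (1 - β * Real.exp (-(lam * d))) * F (x + 1) ≤ F x) :
    ∫⁻ z, (if z.2 = true ∧ max 0 s + d ≤ z.1 then X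
      else shiftMean (poissonMeasure (lam * (s - z.1)).toNNReal) F (x + 1)) ∂proofLaw lam β ≤
      shiftMean (poissonMeasure (lam * s).toNNReal) F x := by
  have := isProbabilityMeasure_expMeasure hlam
  have := isProbabilityMeasure_proofLaw hlam β
  set a := max 0 s with ha
  have ha0 : 0 ≤ a := le_max_left _ _
  have hsa : (lam * s).toNNReal = (lam * a).toNNReal := by
    rcases le_total 0 s with h | h
    · rw [ha, max_eq_right h]
    · rw [ha, max_eq_left h, mul_zero, Real.toNNReal_zero, Real.toNNReal_eq_zero]
      exact mul_nonpos_of_nonneg_of_nonpos hlam.le h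
  set G : ℝ → ENNReal := fun g => shiftMean (poissonMeasure (lam * (s - g)).toNNReal) F (x + 1)
    with hGdef
  have hG : Measurable G := measurable_shiftMean_poisson (by fun_prop) F (x + 1)
  have hGa : ∀ g, a ≤ g → G g = F (x + 1) := by
    intro g hg
    have : lam * (s - g) ≤ 0 :=
      mul_nonpos_of_nonneg_of_nonpos hlam.le (sub_nonpos.2 ((le_max_right _ _).trans hg))
    simp only [G]
    rw [Real.toNNReal_of_nonpos this, shiftMean_poisson_zero]
  have hfst : MeasurePreserving Prod.fst (proofLaw lam β) (expMeasure lam) :=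
    measurePreserving_fst
  -- split by whether the next proof comes in the idle period, and then by whether it is honest
  set I : Set (ℝ × Bool) := Prod.fst ⁻¹' Set.Iio a with hI
  set E : Set (ℝ × Bool) := {z | z.2 = true ∧ a + d ≤ z.1} with hE
  have hIm : MeasurableSet I := measurable_fst measurableSet_Iio
  have hEm : MeasurableSet E :=
    (measurable_snd (measurableSet_singleton true)).inter (measurable_fst measurableSet_Ici)
  have hEI : E ⊆ Iᶜ := fun z hz hzI => by
    have h1 : z.1 < a := hzI
    have h2 := hz.2
    linarith
  have hIc : proofLaw lam β Iᶜ = ENNReal.ofReal (Real.exp (-(lam * a))) := by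
    rw [hI, ← Set.preimage_compl, Set.compl_Iio,
      hfst.measure_preimage measurableSet_Ici.nullMeasurableSet, expMeasure_Ici hlam ha0]
  have hEν : proofLaw lam β E = ENNReal.ofReal (Real.exp (-(lam * a))) *
      ENNReal.ofReal (β * Real.exp (-(lam * d))) := by
    rw [hE, proofLaw_honest hlam β (by positivity), ← ENNReal.ofReal_mul (by positivity), mul_add,
      neg_add, Real.exp_add]
    ring_nf
  have hβd : 0 ≤ β * Real.exp (-(lam * d)) := mul_nonneg β.2.1 (Real.exp_pos _).le
  have hdiff : proofLaw lam β (Iᶜ \ E) = ENNReal.ofReal (Real.exp (-(lam * a))) *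
      ENNReal.ofReal (1 - β * Real.exp (-(lam * d))) := by
    rw [measure_sdiff hEI hEm.nullMeasurableSet (measure_ne_top _ _), hIc, hEν,
      ← ENNReal.ofReal_mul (by positivity), ← ENNReal.ofReal_mul (by positivity),
      ← ENNReal.ofReal_sub _ (by positivity)]
    ring_nf
  set f : ℝ × Bool → ENNReal := fun z => if z.2 = true ∧ a + d ≤ z.1 then X else G z.1
  change ∫⁻ z, f z ∂proofLaw lam β ≤ _
  have hfE : ∀ z ∈ E, f z = X := fun z hz => if_pos hz
  have hfE' : ∀ z ∉ E, f z = G z.1 := fun z hz => if_neg hz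
  have hfI : Set.EqOn f (G ∘ Prod.fst) I := fun z hz => hfE' z fun hzE => hEI hzE hz
  have hfD : Set.EqOn f (fun _ => F (x + 1)) (Iᶜ \ E) := fun z hz =>
    (hfE' z hz.2).trans (hGa z.1 (not_lt.1 hz.1))
  clear_value f G
  have hidle : ∫⁻ z in I, f z ∂proofLaw lam β ≤
      ∫⁻ g in Set.Iio a, shiftMean (poissonMeasure (lam * (a - g)).toNNReal) F (x + 1)
        ∂expMeasure lam := by
    rw [setLIntegral_congr_fun hIm hfI]
    simp only [Function.comp_apply]
    rw [hfst.setLIntegral_comp_preimage measurableSet_Iio hG]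
    rcases le_total 0 s with h | h
    · rw [ha, max_eq_right h, hGdef]
    · rw [ha, max_eq_left h, setLIntegral_measure_zero _ _ (expMeasure_Iio_zero lam)]
      exact zero_le
  rw [hsa, shiftMean_poisson_renewal hlam ha0, ← lintegral_add_compl _ hIm, add_comm]
  refine add_le_add ?_ hidle
  rw [← lintegral_inter_add_sdiff _ Iᶜ hEm, Set.inter_eq_right.2 hEI,
    setLIntegral_congr_fun (g := fun _ => X) hEm hfE,
    setLIntegral_congr_fun (hIm.compl.diff hEm) hfD,
    setLIntegral_const, setLIntegral_const, hEν, hdiff]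
  calc _ = ENNReal.ofReal (Real.exp (-(lam * a))) *
        (ENNReal.ofReal (β * Real.exp (-(lam * d))) * X +
          ENNReal.ofReal (1 - β * Real.exp (-(lam * d))) * F (x + 1)) := by ring
    _ ≤ _ := mul_le_mul_right hX _

/-! ### The geometric law of the lead -/

lemma one_sub_div_mem {p : unitInterval} (hp : 1 / 2 < (p : ℝ)) :
    0 < 1 - (1 - (p : ℝ)) / p ∧ 0 ≤ (1 - (p : ℝ)) / p := by
  have h0 : (0 : ℝ) < p := by linarith
  refine ⟨?_, div_nonneg (sub_nonneg.2 p.2.2) h0.le⟩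
  rw [sub_pos, div_lt_one h0]
  linarith

instance (p : ℝ) : IsProbabilityMeasure (leadLaw p) := by
  unfold leadLaw
  infer_instance

lemma shiftMean_leadLaw {p : unitInterval} (hp : 1 / 2 < (p : ℝ)) (F : ℤ → ENNReal) (x : ℤ) :
    shiftMean (leadLaw p) F x = ENNReal.ofReal (1 - (1 - p) / p) * F x +
      ENNReal.ofReal ((1 - p) / p) * shiftMean (leadLaw p) F (x + 1) := by
  obtain ⟨h1, h2⟩ := one_sub_div_mem hp
  have hproj : Set.projIcc (0 : ℝ) 1 zero_le_one (1 - (1 - (p : ℝ)) / p) =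
      ⟨1 - (1 - (p : ℝ)) / p, h1.le, by linarith⟩ := Set.projIcc_of_mem _ _
  rw [leadLaw, hproj, shiftMean_geometric fun h => h1.ne' (congrArg Subtype.val h)]
  simp

lemma ofReal_add_ofReal_one_sub (p : unitInterval) :
    ENNReal.ofReal p + ENNReal.ofReal (1 - p) = 1 := by
  rw [← ENNReal.ofReal_add p.2.1 (sub_nonneg.2 p.2.2)]
  simp

lemma ofReal_mul_ofReal_div {p : unitInterval} (hp : 1 / 2 < (p : ℝ)) :
    ENNReal.ofReal p * ENNReal.ofReal ((1 - p) / p) = ENNReal.ofReal (1 - p) := by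
  rw [← ENNReal.ofReal_mul p.2.1, mul_div_cancel₀]
  linarith

/-- `1` on the nonnegative integers, `0` elsewhere. -/
def nonnegIndicator (x : ℤ) : ENNReal := if 0 ≤ x then 1 else 0

lemma monotone_nonnegIndicator : Monotone nonnegIndicator := fun x y h => by
  unfold nonnegIndicator
  split_ifs
  · exact le_rfl
  · omega
  · exact zero_le
  · exact le_rfl

lemma nonnegIndicator_le_one (x : ℤ) : nonnegIndicator x ≤ 1 := by
  unfold nonnegIndicator
  split_ifs <;> simp

/-- The probability that a walk on `ℤ` started at `x`, with steps `-1` and `1` of probabilities `p`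
and `1 - p`, ever reaches a nonnegative value. -/
def hitValue (p : ℝ) : ℤ → ENNReal := shiftMean (leadLaw p) nonnegIndicator

lemma hitValue_of_nonneg (p : ℝ) {x : ℤ} (hx : 0 ≤ x) : hitValue p x = 1 := by
  have h : ∀ k : ℕ, nonnegIndicator (x + k) = 1 := fun k => if_pos (by omega)
  simp [hitValue, shiftMean, h]

/-- `hitValue` is harmonic for the walk on the negative integers. -/
lemma hitValue_step {p : unitInterval} (hp : 1 / 2 < (p : ℝ)) {x : ℤ} (hx : x < 0) :
    ENNReal.ofReal p * hitValue p (x - 1) + ENNReal.ofReal (1 - p) * hitValue p (x + 1) =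
      hitValue p x := by
  have h : ∀ y < 0, hitValue p y = ENNReal.ofReal ((1 - p) / p) * hitValue p (y + 1) := by
    intro y hy
    have h0 : nonnegIndicator y = 0 := if_neg (by omega)
    rw [hitValue, shiftMean_leadLaw hp, h0, mul_zero, zero_add]
  calc _ = ENNReal.ofReal p * ENNReal.ofReal ((1 - p) / p) * hitValue p x +
        ENNReal.ofReal p * ENNReal.ofReal ((1 - p) / p) * hitValue p (x + 1) := by
        rw [h (x - 1) (by omega), sub_add_cancel, ofReal_mul_ofReal_div hp, ← mul_assoc,
          ofReal_mul_ofReal_div hp]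
    _ = ENNReal.ofReal (1 - p) * hitValue p x + ENNReal.ofReal p * hitValue p x := by
        rw [mul_assoc _ _ (hitValue p (x + 1)), ← h x hx, ofReal_mul_ofReal_div hp]
    _ = hitValue p x := by
        rw [← add_mul, add_comm, ofReal_add_ofReal_one_sub, one_mul]

lemma shiftMean_leadLaw_reflect {p : unitInterval} (hp : 1 / 2 < (p : ℝ)) (F : ℤ → ENNReal) :
    shiftMean (leadLaw p) (fun y => F (max (y - 1) 0)) 0 =
      ENNReal.ofReal (1 - (1 - p) / p) * F 0 +
        ENNReal.ofReal ((1 - p) / p) * shiftMean (leadLaw p) F 0 := by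
  have h : ∀ k : ℕ, max (0 + 1 + (k : ℤ) - 1) 0 = 0 + k := fun k => by omega
  rw [shiftMean_leadLaw hp]
  simp [shiftMean]

lemma shiftMean_add_const_mul (ν : Measure ℕ) (F G : ℤ → ENNReal) (a b : ENNReal) (x : ℤ) :
    shiftMean ν (fun y => a * F y + b * G (y + 1)) x =
      a * shiftMean ν F x + b * shiftMean ν G (x + 1) := by
  simp only [shiftMean]
  rw [lintegral_add_left .of_discrete, lintegral_const_mul _ .of_discrete,
    lintegral_const_mul _ .of_discrete]
  simp only [add_right_comm]

/-- The geometric law is stationary for the walk reflected at `0`. -/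
lemma shiftMean_leadLaw_step {p : unitInterval} (hp : 1 / 2 < (p : ℝ)) (F : ℤ → ENNReal) :
    shiftMean (leadLaw p) (fun y => ENNReal.ofReal p * F (max (y - 1) 0) +
      ENNReal.ofReal (1 - p) * F (y + 1)) 0 = shiftMean (leadLaw p) F 0 := by
  rw [shiftMean_add_const_mul _ (fun y => F (max (y - 1) 0)), shiftMean_leadLaw_reflect hp]
  have h := shiftMean_leadLaw hp F 0
  have h1 := ofReal_mul_ofReal_div hp
  have h2 := ofReal_add_ofReal_one_sub p
  generalize ENNReal.ofReal (1 - (1 - (p : ℝ)) / p) = a at *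
  generalize ENNReal.ofReal ((1 - (p : ℝ)) / p) = r at *
  generalize ENNReal.ofReal (p : ℝ) = b at *
  rw [← h1] at h2 ⊢
  calc _ = b * (a * F 0 + r * shiftMean (leadLaw p) F (0 + 1)) +
        b * r * shiftMean (leadLaw p) F 0 := by ring
    _ = _ := by rw [← h, ← add_mul, h2, one_mul]

/-- Observed right after its down steps, the reflected walk has a stochastically smaller law than
the stationary one. -/
lemma shiftMean_leadLaw_geometric_le {p : unitInterval} (hp : 1 / 2 < (p : ℝ)) {F : ℤ → ENNReal}
    (hF : Monotone F) (hF1 : ∀ x, F x ≤ 1) :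
    shiftMean (leadLaw p) (shiftMean (geometricMeasure p) fun y => F (max (y - 1) 0)) 0 ≤
      shiftMean (leadLaw p) F 0 := by
  have hp0 : p ≠ 0 := by
    rintro rfl
    norm_num at hp
  set F' : ℤ → ENNReal := fun y => F (max (y - 1) 0) with hF'
  set h := shiftMean (geometricMeasure p) F' with hh
  have hrec : ∀ x, h x = ENNReal.ofReal p * F' x + ENNReal.ofReal (1 - p) * h (x + 1) :=
    shiftMean_geometric hp0 F'
  have hfin : ∀ x, shiftMean (leadLaw p) h x ≠ ⊤ := fun x =>
    ne_top_of_le_ne_top ENNReal.one_ne_top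
      (shiftMean_le_one _ (shiftMean_le_one _ fun y => hF1 _) x)
  have h0 : F 0 ≤ h 0 := by
    have hmono : Monotone F' := fun x y hxy => hF (by omega)
    exact le_shiftMean (geometricMeasure p) hmono 0
  -- compare the recursion of `h` with stationarity, applied to `h`
  have hst := shiftMean_leadLaw_step hp h
  have hrec' : shiftMean (leadLaw p) h 0 = shiftMean (leadLaw p)
      (fun y => ENNReal.ofReal p * F' y + ENNReal.ofReal (1 - p) * h (y + 1)) 0 :=
    congrArg (shiftMean (leadLaw p) · 0) (funext hrec)
  rw [hrec', shiftMean_add_const_mul _ (fun y => h (max (y - 1) 0)) h,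
    shiftMean_add_const_mul _ F' h,
    ENNReal.add_left_inj (ENNReal.mul_ne_top ENNReal.ofReal_ne_top (hfin _)),
    ENNReal.mul_right_inj (ENNReal.ofReal_pos.2 (by linarith)).ne' ENNReal.ofReal_ne_top,
    shiftMean_leadLaw_reflect hp, hF', shiftMean_leadLaw_reflect hp] at hst
  by_cases hr : (1 - (p : ℝ)) / p = 0
  · -- then `p = 1`
    have hp1 : 1 - (p : ℝ) = 0 := by
      rcases div_eq_zero_iff.1 hr with h | h
      · exact h
      · linarith
    rw [shiftMean_leadLaw hp, shiftMean_leadLaw hp F, hrec]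
    simp [hp1, hF']
    exact mul_le_of_le_one_left zero_le (ENNReal.ofReal_le_one.2 p.2.2)
  · have hr0 : ENNReal.ofReal ((1 - (p : ℝ)) / p) ≠ 0 := by
      rw [Ne, ENNReal.ofReal_eq_zero, not_le]
      exact lt_of_le_of_ne (one_sub_div_mem hp).2 (Ne.symm hr)
    rw [← ENNReal.mul_le_mul_iff_right hr0 ENNReal.ofReal_ne_top]
    have hle : ENNReal.ofReal (1 - (1 - p) / p) * F 0 ≤ ENNReal.ofReal (1 - (1 - p) / p) * h 0 :=
      mul_le_mul_right h0 _
    have hF0 : ENNReal.ofReal (1 - (1 - p) / p) * F 0 ≠ ⊤ :=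
      ENNReal.mul_ne_top ENNReal.ofReal_ne_top
        (ne_top_of_le_ne_top ENNReal.one_ne_top (hF1 0))
    refine (ENNReal.add_le_add_iff_left hF0).1 ?_
    rw [← hst]
    exact add_le_add_left hle _

/-! ### The value function of the lead walk -/

/-- The success probability of the adversary at lead `x` when honest miners have just become active
and `j` honest votes are missing; for `j = 0`, when the dissemination of the last ledger begins. -/
def confValue (lam δ Δ p : ℝ) (β : unitInterval) : ℕ → ℤ → ENNReal
  | 0 => shiftMean (poissonMeasure (lam * Δ).toNNReal) (hitValue p)
  | j + 1 => shiftMean (geometricMeasure β) fun y =>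
      shiftMean (poissonMeasure (lam * δ).toNNReal) (confValue lam δ Δ p β j) (y - 1)

/-- The mean of `F` at the lead at the end of the pre-mining phase, `c` steps of the countdown
before, at lead `x`. -/
def preValue (pre : PreMining) (p : unitInterval) (F : ℤ → ENNReal) : ℕ → ℤ → ENNReal
  | 0 => F
  | c + 1 =>
    match pre with
    | .afterProofs _ => fun x => ENNReal.ofReal p * preValue pre p F c (max (x - 1) 0) +
        ENNReal.ofReal (1 - p) * preValue pre p F c (x + 1)
    | .afterHonest _ =>
        shiftMean (geometricMeasure p) fun y => preValue pre p F c (max (y - 1) 0)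

/-- The success probability of the adversary in a state of the lead walk. -/
def walkValue (P : Params) (lam : ℝ) (β p : unitInterval) (a : (ℕ × ℤ × ℕ) × ℝ) : ENNReal :=
  if 0 < a.1.1 then preValue P.pre p (shiftMean (poissonMeasure (lam * P.Δ).toNNReal)
      (confValue lam P.δ P.Δ p β P.L)) a.1.1 a.1.2.1
  else shiftMean (poissonMeasure (lam * a.2).toNNReal)
    (if a.1.2.2 < P.L then confValue lam P.δ P.Δ p β (P.L - a.1.2.2) else hitValue p) a.1.2.1

lemma confValue_mono_le_one (lam δ Δ p : ℝ) (β : unitInterval) (j : ℕ) :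
    Monotone (confValue lam δ Δ p β j) ∧ ∀ x, confValue lam δ Δ p β j x ≤ 1 := by
  induction j with
  | zero =>
    exact ⟨monotone_shiftMean _ (monotone_shiftMean _ monotone_nonnegIndicator),
      shiftMean_le_one _ (shiftMean_le_one _ nonnegIndicator_le_one)⟩
  | succ j ih =>
    exact ⟨monotone_shiftMean _ fun x y h => monotone_shiftMean _ ih.1 (by omega),
      shiftMean_le_one _ fun x => shiftMean_le_one _ ih.2 _⟩

lemma preValue_mono_le_one (pre : PreMining) (p : unitInterval) {F : ℤ → ENNReal}
    (hF : Monotone F) (hF1 : ∀ x, F x ≤ 1) (c : ℕ) :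
    Monotone (preValue pre p F c) ∧ ∀ x, preValue pre p F c x ≤ 1 := by
  induction c with
  | zero => exact ⟨hF, hF1⟩
  | succ c ih =>
    cases pre with
    | afterProofs n =>
      refine ⟨fun x y h => add_le_add (mul_le_mul_right (ih.1 (by omega)) _)
        (mul_le_mul_right (ih.1 (by omega)) _), fun x => ?_⟩
      calc _ ≤ ENNReal.ofReal p * 1 + ENNReal.ofReal (1 - p) * 1 :=
            add_le_add (mul_le_mul_right (ih.2 _) _) (mul_le_mul_right (ih.2 _) _)
        _ = 1 := by rw [mul_one, mul_one, ofReal_add_ofReal_one_sub]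
    | afterHonest k =>
      exact ⟨monotone_shiftMean (geometricMeasure p)
        (F := fun y => preValue (.afterHonest k) p F c (max (y - 1) 0))
        fun x y h => ih.1 (by omega),
        shiftMean_le_one (geometricMeasure p)
        (F := fun y => preValue (.afterHonest k) p F c (max (y - 1) 0)) fun x => ih.2 _⟩

/-- Whatever ends the pre-mining phase, the lead at its end is stochastically dominated by the
geometric law. -/
lemma preValue_le_shiftMean_leadLaw (pre : PreMining) {p : unitInterval} (hp : 1 / 2 < (p : ℝ))
    {F : ℤ → ENNReal} (hF : Monotone F) (hF1 : ∀ x, F x ≤ 1) (c : ℕ) :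
    preValue pre p F c 0 ≤ shiftMean (leadLaw p) F 0 := by
  refine (le_shiftMean (leadLaw p) (preValue_mono_le_one pre p hF hF1 c).1 0).trans ?_
  induction c with
  | zero => exact le_rfl
  | succ c ih =>
    refine le_trans ?_ ih
    obtain ⟨h1, h2⟩ := preValue_mono_le_one pre p hF hF1 c
    cases pre with
    | afterProofs n => exact (shiftMean_leadLaw_step hp _).le
    | afterHonest k => exact shiftMean_leadLaw_geometric_le hp h1 h2

lemma preValue_countdown (pre : PreMining) {p : unitInterval} (hp : p ≠ 0) (F : ℤ → ENNReal)
    {c : ℕ} (hc : 0 < c) (x : ℤ) :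
    ENNReal.ofReal p * preValue pre p F (pre.countdown c true) (max (x - 1) 0) +
      ENNReal.ofReal (1 - p) * preValue pre p F (pre.countdown c false) (x + 1) =
      preValue pre p F c x := by
  obtain ⟨c, rfl⟩ := Nat.exists_eq_succ_of_ne_zero hc.ne'
  cases pre with
  | afterProofs n => rfl
  | afterHonest k =>
    exact (shiftMean_geometric hp
      (fun y => preValue (.afterHonest k) p F c (max (y - 1) 0)) x).symm

lemma walkValue_start {P : Params} (hL : 1 ≤ P.L) (lam : ℝ) (β p : unitInterval) (c : ℕ) (x : ℤ) :
    walkValue P lam β p ((c, x, 0), P.Δ) = preValue P.pre p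
      (shiftMean (poissonMeasure (lam * P.Δ).toNNReal) (confValue lam P.δ P.Δ p β P.L)) c x := by
  unfold walkValue
  split_ifs with h1 h2
  · rfl
  · obtain rfl : c = 0 := Nat.eq_zero_of_not_pos h1
    rfl
  · exact absurd hL (by simpa using h2)

lemma one_le_walkValue {P : Params} (lam : ℝ) (β p : unitInterval) {a : (ℕ × ℤ × ℕ) × ℝ}
    (ha : a ∈ winStates P) : 1 ≤ walkValue P lam β p a := by
  obtain ⟨h1, h2, h3⟩ := ha
  rw [walkValue, if_neg (by omega), if_neg (by omega), ← hitValue_of_nonneg p h3]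
  exact le_shiftMean _ (monotone_shiftMean _ monotone_nonnegIndicator) _

lemma lintegral_proofLaw_ite_le {lam d : ℝ} (hlam : 0 < lam) (hd : 0 ≤ d) (β : unitInterval)
    (X Y : ENNReal) :
    ∫⁻ z, (if z.2 = true ∧ d ≤ z.1 then X else Y) ∂proofLaw lam β ≤
      ENNReal.ofReal (β * Real.exp (-(lam * d))) * X +
      ENNReal.ofReal (1 - β * Real.exp (-(lam * d))) * Y := by
  set C := ENNReal.ofReal (β * Real.exp (-(lam * d))) * X +
      ENNReal.ofReal (1 - β * Real.exp (-(lam * d))) * Y with hC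
  have h := lintegral_proofLaw_le (s := 0) hlam hd β (fun y => if y ≤ 0 then C else Y) 0 X
    (by simp [hC])
  have hY : ∀ g : ℝ, shiftMean (poissonMeasure (lam * (0 - g)).toNNReal)
      (fun y => if y ≤ 0 then C else Y) 1 = Y := by
    intro g
    have h1 : ∀ k : ℕ, ¬ (1 + (k : ℤ) ≤ 0) := fun k => by omega
    simp only [shiftMean, h1, if_false]
    simp
  simp only [hY, max_self, zero_add, mul_zero, Real.toNNReal_zero, shiftMean_poisson_zero,
    le_refl, if_true] at h
  exact h

/-- Outside `winStates`, the value function does not increase in mean. -/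
lemma lintegral_walkValue_le {P : Params} (hL : 1 ≤ P.L) (hδ : 0 ≤ P.δ) (hΔ : 0 ≤ P.Δ) {lam : ℝ}
    (hlam : 0 < lam) {β p : unitInterval} (hp : (p : ℝ) = β * Real.exp (-(lam * P.δ)))
    (hp2 : 1 / 2 < (p : ℝ)) {a : (ℕ × ℤ × ℕ) × ℝ} (ha : a ∉ winStates P) :
    ∫⁻ z, walkValue P lam β p (walkStep P a z) ∂proofLaw lam β ≤ walkValue P lam β p a := by
  have hp0 : p ≠ 0 := by
    rintro rfl
    norm_num at hp2
  have hβ0 : β ≠ 0 := by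
    rintro rfl
    norm_num [hp] at hp2
  obtain ⟨⟨c, x, v⟩, s⟩ := a
  by_cases hc : 0 < c
  · -- pre-mining
    simp only [walkStep, if_pos hc, apply_ite (walkValue P lam β p), walkValue_start hL]
    refine (lintegral_proofLaw_ite_le hlam hδ β _ _).trans ?_
    rw [← hp, preValue_countdown _ hp0 _ hc]
    simp [walkValue, hc]
  obtain rfl : c = 0 := Nat.eq_zero_of_not_pos hc
  have hval : ∀ x v s, walkValue P lam β p ((0, x, v), s) =
      shiftMean (poissonMeasure (lam * s).toNNReal)
      (if v < P.L then confValue lam P.δ P.Δ p β (P.L - v) else hitValue p) x :=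
    fun _ _ _ => rfl
  by_cases hv : v < P.L
  · -- confirmation interval
    obtain ⟨j, hj⟩ : ∃ j, P.L - v = j + 1 := ⟨P.L - v - 1, by omega⟩
    set F := confValue lam P.δ P.Δ p β (j + 1)
    set X := shiftMean (poissonMeasure (lam * P.δ).toNNReal) (confValue lam P.δ P.Δ p β j) (x - 1)
    have hX : walkValue P lam β p
        ((0, x - 1, v + 1), P.δ + if v + 1 = P.L then P.Δ else 0) = X := by
      rw [hval]
      by_cases hvL : v + 1 = P.L
      · obtain rfl : j = 0 := by omega
        rw [if_pos hvL, if_neg (by omega), mul_add,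
          shiftMean_poisson_add (by positivity) (by positivity)]
        rfl
      · rw [if_neg hvL, if_pos (by omega), add_zero, show P.L - (v + 1) = j by omega]
    rw [hval, if_pos hv, hj]
    refine le_trans (le_of_eq ?_) (lintegral_proofLaw_le (d := 0) hlam le_rfl β F x X ?_)
    · -- almost surely the gap is nonnegative and does not equal `s`
      have hfst : Measure.QuasiMeasurePreserving Prod.fst (proofLaw lam β) (expMeasure lam) :=
        Measure.quasiMeasurePreserving_fst
      have h1 : ∀ᵐ z ∂proofLaw lam β, z.1 ≠ s :=
        hfst.ae (measure_eq_zero_iff_ae_notMem.1 (expMeasure_singleton lam s))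
      have h2 : ∀ᵐ z ∂proofLaw lam β, 0 ≤ z.1 := by
        filter_upwards [hfst.ae (measure_eq_zero_iff_ae_notMem.1 (expMeasure_Iio_zero lam))]
          with z hz using not_lt.1 hz
      refine lintegral_congr_ae ?_
      filter_upwards [h1, h2] with z hz1 hz2
      have hiff : s < z.1 ↔ max 0 s + 0 ≤ z.1 := by
        rw [add_zero, max_le_iff]
        exact ⟨fun h => ⟨hz2, h.le⟩, fun h => lt_of_le_of_ne h.2 (Ne.symm hz1)⟩
      simp only [walkStep, lt_irrefl, if_false, if_pos hv, ← hiff]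
      by_cases hz : z.2 = true ∧ s < z.1
      · rw [if_pos hz, if_pos hz, hX]
      · rw [if_neg hz, if_neg hz, hval, if_pos hv, hj]
    · simp only [mul_zero, neg_zero, Real.exp_zero, mul_one]
      exact (shiftMean_geometric hβ0 (fun y => shiftMean (poissonMeasure (lam * P.δ).toNNReal)
        (confValue lam P.δ P.Δ p β j) (y - 1)) x).ge
  · -- after the confirmation
    have hx : x < 0 := by
      by_contra! hx
      exact ha ⟨rfl, not_lt.1 hv, hx⟩
    rw [hval, if_neg hv]
    refine le_trans (le_of_eq ?_)
      (lintegral_proofLaw_le (d := P.δ) hlam hδ β (hitValue p) x (hitValue p (x - 1)) ?_)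
    · refine lintegral_congr fun z => ?_
      simp only [walkStep, lt_irrefl, if_false, if_neg hv]
      split_ifs with h
      · have h0 : lam * (s - z.1) ≤ 0 :=
          mul_nonpos_of_nonneg_of_nonpos hlam.le (by linarith [h.2, le_max_right 0 s])
        rw [hval, if_neg hv, Real.toNNReal_of_nonpos h0, shiftMean_poisson_zero]
      · rw [hval, if_neg hv]
    · rw [← hp]
      exact (hitValue_step hp2 hx).le

lemma measurable_walkValue (P : Params) (lam : ℝ) (β p : unitInterval) :
    Measurable (walkValue P lam β p) := by
  refine measurable_from_prod_countable_right fun d => ?_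
  by_cases hc : 0 < d.1
  · simp only [walkValue, if_pos hc]
    exact measurable_const
  · simp only [walkValue, if_neg hc]
    exact measurable_shiftMean_poisson (by fun_prop) _ _

lemma measurable_walkStep (P : Params) : Measurable (Function.uncurry (walkStep P)) := by
  have hb : MeasurableSet {q : ℝ × ℝ × Bool | q.2.2 = true} :=
    measurable_snd.snd (measurableSet_singleton true)
  have hd : ∀ d : ℕ × ℤ × ℕ, Measurable fun q : ℝ × ℝ × Bool => walkStep P (d, q.1) q.2 := by
    intro d
    by_cases hc : 0 < d.1
    · have h : MeasurableSet {q : ℝ × ℝ × Bool | P.δ ≤ q.2.1} :=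
        measurableSet_le (by fun_prop) (by fun_prop)
      simp only [walkStep, if_pos hc]
      exact Measurable.ite (hb.inter h) measurable_const measurable_const
    by_cases hv : d.2.2 < P.L
    · have h : MeasurableSet {q : ℝ × ℝ × Bool | q.1 < q.2.1} :=
        measurableSet_lt (by fun_prop) (by fun_prop)
      obtain ⟨w, hw⟩ : ∃ w, w = P.δ + if d.2.2 + 1 = P.L then P.Δ else 0 := ⟨_, rfl⟩
      simp only [walkStep, if_neg hc, if_pos hv, ← hw]
      exact Measurable.ite (hb.inter h) measurable_const (by fun_prop)
    · have h : MeasurableSet {q : ℝ × ℝ × Bool | max 0 q.1 + P.δ ≤ q.2.1} :=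
        measurableSet_le (by fun_prop) (by fun_prop)
      simp only [walkStep, if_neg hc, if_neg hv]
      exact Measurable.ite (hb.inter h) (by fun_prop) (by fun_prop)
  have h := measurable_from_prod_countable_right (f := fun q : (ℕ × ℤ × ℕ) × ℝ × ℝ × Bool =>
    walkStep P (q.1, q.2.1) q.2.2) hd
  exact h.comp (f := fun q : ((ℕ × ℤ × ℕ) × ℝ) × ℝ × Bool => (q.1.1, q.1.2, q.2)) (by fun_prop)

lemma measurableSet_winStates (P : Params) : MeasurableSet (winStates P) :=
  measurable_fst (t := {d : ℕ × ℤ × ℕ | d.1 = 0 ∧ P.L ≤ d.2.2 ∧ 0 ≤ d.2.1}) .of_discrete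

instance (n : ℕ) (β : unitInterval) : IsProbabilityMeasure (negBin n β) := by
  unfold negBin
  infer_instance

/-- Each missing honest vote adds a geometric and a Poisson number of adversarial proofs. -/
lemma confValue_eq (lam δ Δ p : ℝ) (β : unitInterval) (j : ℕ) :
    confValue lam δ Δ p β j = fun x => shiftMean (negBin j β)
      (shiftMean (iidSum j (poissonMeasure (lam * δ).toNNReal))
        (shiftMean (poissonMeasure (lam * Δ).toNNReal) (hitValue p))) (x - j) := by
  induction j with
  | zero => simp [confValue, negBin, iidSum_zero, shiftMean_dirac_zero]
  | succ j ih =>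
    ext x
    have hN : negBin (j + 1) β = (geometricMeasure β).conv (negBin j β) := iidSum_succ j _
    set A := shiftMean (negBin j β) (shiftMean (iidSum j (poissonMeasure (lam * δ).toNNReal))
        (shiftMean (poissonMeasure (lam * Δ).toNNReal) (hitValue p))) with hA
    have hx : x - 1 - j = x - ((j + 1 : ℕ) : ℤ) := by
      push_cast
      ring
    rw [confValue, shiftMean_translate _ (shiftMean _ _) 1, ih, shiftMean_translate _ A j,
      shiftMean_translate _ (shiftMean _ A) j]
    beta_reduce
    rw [hx, hN, iidSum_succ, shiftMean_conv, shiftMean_conv,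
      hA, shiftMean_comm _ (negBin j β)]

/-- Averaging the value at `τ` over a geometric lead gives the bound. -/
lemma shiftMean_leadLaw_confValue (L : ℕ) (lam δ Δ p : ℝ) (β : unitInterval) :
    shiftMean (leadLaw p) (shiftMean (poissonMeasure (lam * Δ).toNNReal)
      (confValue lam δ Δ p β L)) 0 = attackLaw L lam β δ Δ p {n | L ≤ n} := by
  have h : attackLaw L lam β δ Δ p {n | L ≤ n} =
      shiftMean (attackLaw L lam β δ Δ p) nonnegIndicator (0 - L) := by
    rw [← lintegral_indicator_one .of_discrete, shiftMean]
    refine lintegral_congr fun n => ?_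
    by_cases hn : L ≤ n
    · rw [Set.indicator_of_mem (s := {n | L ≤ n}) hn, nonnegIndicator,
        if_pos (by omega), Pi.one_apply]
    · rw [Set.indicator_of_notMem (s := {n | L ≤ n}) hn, nonnegIndicator, if_neg (by omega)]
  rw [h, attackLaw, confValue_eq, shiftMean_translate _ (shiftMean _ _) L,
    shiftMean_translate _ (shiftMean _ _) L, shiftMean_conv, shiftMean_conv, shiftMean_conv,
    shiftMean_conv,
    iidSum_succ, iidSum_succ, iidSum_zero, shiftMean_conv, shiftMean_conv, shiftMean_dirac_zero,
    shiftMean_comm _ (negBin L β), shiftMean_comm _ (iidSum L _)]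
  rfl

/-! ### The pre-mining phase ends almost surely -/

lemma exists_le_preHonestCount {P : Params} {m : MiningPath}
    (h : ∀ n, ∃ i, n < i ∧ preHonest P m i) (k : ℕ) : ∃ n, k ≤ preHonestCount P m n := by
  have hmono : Monotone (preHonestCount P m) := monotone_nat_of_le_succ fun n => by
    rw [preHonestCount_succ]
    omega
  induction k with
  | zero => exact ⟨0, Nat.zero_le _⟩
  | succ k ih =>
    obtain ⟨n, hn⟩ := ih
    obtain ⟨i, hni, hi⟩ := h n
    obtain ⟨j, rfl⟩ : ∃ j, i = j + 1 := ⟨i - 1, by omega⟩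
    refine ⟨j + 1, ?_⟩
    rw [preHonestCount_succ, if_pos hi]
    exact Nat.succ_le_succ (hn.trans (hmono (by omega)))

/-- By the Borel-Cantelli lemma, there are infinitely many honest proofs. -/
lemma ae_preMiningEnds {Ω : Type*} [MeasurableSpace Ω] {μ : Measure Ω} [IsProbabilityMeasure μ]
    {P : Params} (hδ : 0 ≤ P.δ) {lam : ℝ} (hlam : 0 < lam) {β : unitInterval} (hβ : β ≠ 0)
    {z : ℕ → Ω → ℝ × Bool} (hz : ∀ i, Measurable (z i)) (hind : iIndepFun z μ)
    (hlaw : ∀ i, μ.map (z i) = proofLaw lam β) :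
    ∀ᵐ ω ∂μ, PreMiningEnds P ⟨fun i => (z i ω).1, fun i => (z i ω).2⟩ := by
  set E : Set (ℝ × Bool) := {y | y.2 = true ∧ P.δ ≤ y.1}
  have hE : MeasurableSet E :=
    (measurable_snd (measurableSet_singleton true)).inter (measurable_fst measurableSet_Ici)
  have hμ : ∀ i, μ (z i ⁻¹' E) = ENNReal.ofReal (β * Real.exp (-(lam * P.δ))) := fun i => by
    rw [← Measure.map_apply (hz i) hE, hlaw, proofLaw_honest hlam β hδ]
  have hβ' : 0 < (β : ℝ) := lt_of_le_of_ne β.2.1 fun h => hβ (Subtype.ext h.symm)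
  have hlim : μ (Filter.limsup (fun i => z i ⁻¹' E) Filter.atTop) = 1 := by
    refine measure_limsup_eq_one (fun i => hz i hE) ?_ ?_
    · rw [iIndepSet_iff_meas_biInter fun i => hz i hE]
      exact fun S => hind.measure_inter_preimage_eq_mul S fun _ _ => hE
    · simp only [hμ]
      refine ENNReal.tsum_const_eq_top_of_ne_zero (ne_of_gt ?_)
      exact ENNReal.ofReal_pos.2 (mul_pos hβ' (Real.exp_pos _))
  have hae : ∀ᵐ ω ∂μ, ω ∈ Filter.limsup (fun i => z i ⁻¹' E) Filter.atTop :=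
    (prob_compl_eq_zero_iff (MeasurableSet.measurableSet_limsup fun i => hz i hE)).2 hlim
  filter_upwards [hae] with ω hω k _
  rw [Filter.mem_limsup_iff_frequently_mem, Filter.frequently_atTop] at hω
  refine exists_le_preHonestCount (fun n => ?_) k
  obtain ⟨i, hi, h1, h2⟩ := hω (n + 1)
  exact ⟨i, by omega, by omega, h1, h2⟩

end RiggedPoW

end

theorem mainTheorem1 {Ω : Type*} [MeasurableSpace Ω] (μ : Measure Ω) [IsProbabilityMeasure μ]
    {Ledger : Type*}
    -- protocol and network parameters
    (L : ℕ) (hL : 1 ≤ L) (lamB lamP δ Δ p : ℝ) (β : unitInterval) (pre : RiggedPoW.PreMining)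
    (hlamB : 0 < lamB) (hlamP : lamP = L * lamB) (hδ : 0 ≤ δ) (hΔ : 0 ≤ Δ)
    (hp : p = β * Real.exp (-(lamP * δ))) (hp_half : 1 / 2 < p)
    -- the mining process
    (gap : ℕ → Ω → ℝ) (byHonest : ℕ → Ω → Bool)
    (hmining : RiggedPoW.IsMining μ lamP β gap byHonest)
    -- an arbitrary adversary, which determines the proof tree that arises
    (tree : Ω → RiggedPoW.ProofTree Ledger)
    (htree : ∀ᵐ ω ∂μ, RiggedPoW.FollowsProtocol ⟨L, δ, Δ, pre⟩
      ⟨fun i => gap i ω, fun i => byHonest i ω⟩ (tree ω)) :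
    μ {ω | RiggedPoW.Discarded ⟨L, δ, Δ, pre⟩
        ⟨fun i => gap i ω, fun i => byHonest i ω⟩ (tree ω)} ≤
      RiggedPoW.attackLaw L lamP β δ Δ p {n | L ≤ n} := by
  open RiggedPoW in
  have hlam : 0 < lamP := by
    rw [hlamP]
    exact mul_pos (by exact_mod_cast hL) hlamB
  have hβ : β ≠ 0 := by
    rintro rfl
    norm_num [hp] at hp_half
  have hp1 : p ≤ 1 := by
    rw [hp]
    exact mul_le_one₀ β.2.2 (Real.exp_pos _).le
      (Real.exp_le_one_iff.2 (by linarith [mul_nonneg hlam.le hδ]))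
  obtain ⟨p, rfl⟩ : ∃ p' : unitInterval, (p' : ℝ) = p := ⟨⟨p, by linarith, hp1⟩, rfl⟩
  set P : Params := ⟨L, δ, Δ, pre⟩
  -- measurable versions of the inputs
  set z : ℕ → Ω → ℝ × Bool := fun i => (hmining.law i).aemeasurable.mk _
  have hz : ∀ i, Measurable (z i) := fun i => (hmining.law i).aemeasurable.measurable_mk
  have hzae : ∀ i, (fun ω => (gap i ω, byHonest i ω)) =ᵐ[μ] z i :=
    fun i => (hmining.law i).aemeasurable.ae_eq_mk
  have hind : iIndepFun z μ := hmining.indep.congr hzae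
  have hlaw : ∀ i, μ.map (z i) = proofLaw lamP β := fun i => by
    rw [← Measure.map_congr (hzae i), (hmining.law i).map_eq, proofLaw]
  have hends := ae_preMiningEnds (P := P) hδ hlam hβ hz hind hlaw
  have := isProbabilityMeasure_proofLaw hlam β
  calc _ ≤ μ {ω | ∃ n, drivenChain (walkStep P) ((P.pre.start, 0, 0), P.Δ)
          (fun i => z i ω) n ∈ winStates P} := by
        refine measure_mono_ae ?_
        filter_upwards [htree, hends, ae_all_iff.2 hzae] with ω ht he hzω hd
        have hm : (⟨fun i => (z i ω).1, fun i => (z i ω).2⟩ : MiningPath) =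
            ⟨fun i => gap i ω, fun i => byHonest i ω⟩ := by
          simp only [← hzω]
        rw [hm] at he
        obtain ⟨n, hn⟩ := ht.exists_leadWalk_mem_winStates hL he hd
        rw [← hm] at hn
        exact ⟨n, hn⟩
    _ ≤ walkValue P lamP β p ((P.pre.start, 0, 0), P.Δ) :=
        measure_exists_drivenChain_mem_le (measurable_walkStep P) _ hz hind hlaw
          (measurable_walkValue P lamP β p) (measurableSet_winStates P)
          (fun a ha => one_le_walkValue lamP β p ha)
          (fun a ha => lintegral_walkValue_le hL hδ hΔ hlam hp hp_half ha)
    _ ≤ _ := by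
        obtain ⟨h1, h2⟩ := confValue_mono_le_one lamP δ Δ p β L
        rw [walkValue_start hL, ← shiftMean_leadLaw_confValue]
        exact preValue_le_shiftMean_leadLaw _ hp_half (monotone_shiftMean _ h1)
          (shiftMean_le_one _ h2) _
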